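/- A relational event graph $G$ consists of a vertex set $V=\{0,\dots,n-1\}$ and a sequence of edges $e_0,\dots,e_{m-1}$, each joining a pair of vertices (repeated pairs and loops are allowed; directions, if given, are ignored). For $0\le i\le j<m$ the slice $G_{i,j}$ is the multigraph with vertex set $V$ and edges $e_i,\dots,e_j$. A connected component of a slice is *loopy* if it contains at least one cycle (a loop is a cycle of length one, and two parallel edges form a cycle of length two), and a *tree component* otherwise; a tree component is *nontrivial* if it has more than one vertex. A dominance counting data set is a set of at most $N$ integer points $(x,y)$ with $1\le y\le x\le N$; a dominance counting query asks for the number of its points in one of the four closed axis-parallel quadrants at a query point $(x_0,y_0)$. A quantity $f$ of slices is said to be reducible to dominance counting in time $O(T(n,m))$ and linear space if there are a random access machine program, a constant $C$ and a finite list of dominance queries, none of them depending on $G$, such that for every $G$ the program, given $n$, $m$ and the endpoints of $e_0,\dots,e_{m-1}$ (all other memory being zero), halts within $C\,T(n,m)$ steps, using a fixed number of registers and of arrays with at most $C(n+m+1)$ cells each, all words being natural numbers below $C(n+m+1)$, and leaves in memory finitely many dominance counting data sets with $N\le Cm$, such that for all $0\le i\le j<m$ the value $f(G_{i,j})$ is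 the sum of an affine form in $n,m,i,j$ with fixed integer coefficients and a fixed integer linear combination of the counts of the listed dominance queries on these data sets, where the coordinates of the query points are affine forms in $n,m,i,j$ with fixed integer coefficients. **Theorem.** Each of the following quantities of the slices $G_{i,j}$ of a relational event graph is reducible to dominance counting in time $O(m\log n)$ and linear space: the number of loopy components, the number of tree components, and the number of nontrivial tree components. Here $O(m\log n)$ is read as $O(m(\lfloor\log_2 n\rfloor+1)+1)$, so that the cases $n\le 1$ and $m=0$ are covered. -/

import Mathlib

/-! ## Components of multigraphs -/

namespace Graph

variable {α β : Type*}

/-- A cycle of length `l + 1` in a multigraph: distinct vertices `v 0, …, v l` and distinct edges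
`e 0, …, e l`, where `e t` joins `v t` to `v (t + 1)` and the index `t + 1` is taken modulo
`l + 1`. A loop is a cycle of length one, two parallel edges form a cycle of length two. -/
structure IsCycleOn (G : Graph α β) {l : ℕ} (v : Fin (l + 1) → α) (e : Fin (l + 1) → β) :
    Prop where
  vertex_injective : Function.Injective v
  edge_injective : Function.Injective e
  isLink : ∀ t, G.IsLink (e t) (v t) (v (t + 1))

/-- The connected components of a multigraph (those of its underlying simple graph). -/
abbrev Component (G : Graph α β) : Type _ := G.toSimpleGraph.ConnectedComponent

/-- A component is loopy if it contains at least one cycle. -/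
def IsLoopy (G : Graph α β) (c : G.Component) : Prop :=
  ∃ (l : ℕ) (v : Fin (l + 1) → G.vertexSet) (e : Fin (l + 1) → β),
    G.IsCycleOn (fun t => (v t : α)) e ∧ ∀ t, v t ∈ c.supp

/-- A component is a tree if it contains no cycle (it is connected, being a component). -/
def IsTreeComponent (G : Graph α β) (c : G.Component) : Prop := ¬ G.IsLoopy c

/-- The number of loopy components. -/
noncomputable def loopyComponentCount (G : Graph α β) : ℕ :=
  Nat.card {c : G.Component // G.IsLoopy c}

/-- The number of tree components, single vertices without edges included. -/
noncomputable def treeComponentCount (G : Graph α β) : ℕ :=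
  Nat.card {c : G.Component // G.IsTreeComponent c}

/-- The number of tree components with more than one vertex. -/
noncomputable def nontrivialTreeComponentCount (G : Graph α β) : ℕ :=
  Nat.card {c : G.Component // G.IsTreeComponent c ∧ c.supp.Nontrivial}

end Graph

/-! ## Relational event graphs and their slices -/

/-- A relational event graph: a vertex set `{0, …, n - 1}` and a sequence of `m` edges, each given
by the pair of its endpoints. Pairs may repeat. The order inside a pair plays no role for the
components of slices, so directed and undirected event graphs are both covered. -/
structure RelationalEventGraph where
  n : ℕ
  m : ℕ
  edge : Fin m → Fin n × Fin n

/-- The slice multigraph `G_{i,j}`: all the vertices, and the edges `e_k` with `i ≤ k ≤ j`. -/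
def RelationalEventGraph.slice (G : RelationalEventGraph) (i j : ℕ) :
    Graph (Fin G.n) (Fin G.m) where
  vertexSet := Set.univ
  IsLink k u v := (i ≤ (k : ℕ) ∧ (k : ℕ) ≤ j) ∧ (G.edge k = (u, v) ∨ G.edge k = (v, u))
  isLink_symm := fun _ _ => ⟨fun _ _ h => ⟨h.1, h.2.symm⟩⟩
  eq_or_eq_of_isLink_of_isLink := by
    rintro k x y v w ⟨-, h | h⟩ ⟨-, h' | h'⟩ <;> rw [h] at h' <;> simp_all
  left_mem_of_isLink := fun _ _ _ _ => Set.mem_univ _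

/-! ## A random access machine with a step count

Programs of a structured imperative language over words: a fixed finite number of registers and of
arrays, with addition, (truncated) subtraction, comparison and indirect addressing. Every
elementary operation costs one step. The machine is restricted: words hold numbers below `W`, and
arrays have `S` cells each. An overflowing operation or an access outside of an array has no
result, so that a program that attempts it has no run. -/

namespace RAM

/-- Memory contents: registers and arrays, each addressed by natural numbers. -/
structure Memory where
  reg : ℕ → ℕ
  arr : ℕ → ℕ → ℕ

def Memory.setReg (σ : Memory) (x v : ℕ) : Memory :=
  { σ with reg := Function.update σ.reg x v }

def Memory.setArr (σ : Memory) (a i v : ℕ) : Memory :=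
  { σ with arr := Function.update σ.arr a (Function.update (σ.arr a) i v) }

inductive Expr where
  | lit (c : ℕ)
  | reg (x : ℕ)
  | get (a : ℕ) (i : Expr)
  | add (e₁ e₂ : Expr)
  | sub (e₁ e₂ : Expr)

/-- A word: a number below `W`. -/
def toWord (W v : ℕ) : Option ℕ := if v < W then some v else none

/-- The value of an expression on the machine with word bound `W` and `S` cells per array. -/
def Expr.eval (W S : ℕ) (σ : Memory) : Expr → Option ℕ
  | .lit c => toWord W c
  | .reg x => toWord W (σ.reg x)
  | .get a i => do
      let k ← i.eval W S σ
      if k < S then toWord W (σ.arr a k) else none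
  | .add e₁ e₂ => do
      let v₁ ← e₁.eval W S σ
      let v₂ ← e₂.eval W S σ
      toWord W (v₁ + v₂)
  | .sub e₁ e₂ => do
      let v₁ ← e₁.eval W S σ
      let v₂ ← e₂.eval W S σ
      toWord W (v₁ - v₂)

/-- The number of steps to evaluate an expression: one for each operation in it. -/
def Expr.cost : Expr → ℕ
  | .lit _ => 1
  | .reg _ => 1
  | .get _ i => i.cost + 1
  | .add e₁ e₂ => e₁.cost + e₂.cost + 1
  | .sub e₁ e₂ => e₁.cost + e₂.cost + 1

/-- Tests. -/
inductive Cond where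
  | eq (e₁ e₂ : Expr)
  | lt (e₁ e₂ : Expr)
  | not (b : Cond)
  | and (b₁ b₂ : Cond)

def Cond.eval (W S : ℕ) (σ : Memory) : Cond → Option Bool
  | .eq e₁ e₂ => do
      let v₁ ← e₁.eval W S σ
      let v₂ ← e₂.eval W S σ
      return decide (v₁ = v₂)
  | .lt e₁ e₂ => do
      let v₁ ← e₁.eval W S σ
      let v₂ ← e₂.eval W S σ
      return decide (v₁ < v₂)
  | .not b => do
      let v ← b.eval W S σ
      return !v
  | .and b₁ b₂ => do
      let v₁ ← b₁.eval W S σ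
      let v₂ ← b₂.eval W S σ
      return v₁ && v₂

def Cond.cost : Cond → ℕ
  | .eq e₁ e₂ => e₁.cost + e₂.cost + 1
  | .lt e₁ e₂ => e₁.cost + e₂.cost + 1
  | .not b => b.cost + 1
  | .and b₁ b₂ => b₁.cost + b₂.cost + 1

inductive Program where
  | skip
  | assign (x : ℕ) (e : Expr)
  | store (a : ℕ) (i e : Expr)
  | seq (p q : Program)
  | ite (b : Cond) (p q : Program)
  | while (b : Cond) (p : Program)

/-- `Run W S p σ t τ`: on the machine with word bound `W` and `S` cells per array, the program `p`
started with memory `σ` halts after exactly `t` steps with memory `τ`. -/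
inductive Run (W S : ℕ) : Program → Memory → ℕ → Memory → Prop where
  | skip (σ : Memory) : Run W S .skip σ 1 σ
  | assign {x : ℕ} {e : Expr} {σ : Memory} {v : ℕ} (he : e.eval W S σ = some v) :
      Run W S (.assign x e) σ (e.cost + 1) (σ.setReg x v)
  | store {a : ℕ} {i e : Expr} {σ : Memory} {k v : ℕ} (hi : i.eval W S σ = some k) (hk : k < S)
      (he : e.eval W S σ = some v) :
      Run W S (.store a i e) σ (i.cost + e.cost + 1) (σ.setArr a k v)
  | seq {p q : Program} {σ σ' σ'' : Memory} {t t' : ℕ} (hp : Run W S p σ t σ')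
      (hq : Run W S q σ' t' σ'') : Run W S (.seq p q) σ (t + t') σ''
  | ite_true {b : Cond} {p q : Program} {σ σ' : Memory} {t : ℕ} (hb : b.eval W S σ = some true)
      (hp : Run W S p σ t σ') : Run W S (.ite b p q) σ (b.cost + 1 + t) σ'
  | ite_false {b : Cond} {p q : Program} {σ σ' : Memory} {t : ℕ} (hb : b.eval W S σ = some false)
      (hq : Run W S q σ t σ') : Run W S (.ite b p q) σ (b.cost + 1 + t) σ'
  | while_true {b : Cond} {p : Program} {σ σ' σ'' : Memory} {t t' : ℕ}
      (hb : b.eval W S σ = some true) (hp : Run W S p σ t σ')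
      (hw : Run W S (.while b p) σ' t' σ'') : Run W S (.while b p) σ (b.cost + 1 + t + t') σ''
  | while_false {b : Cond} {p : Program} {σ : Memory} (hb : b.eval W S σ = some false) :
      Run W S (.while b p) σ (b.cost + 1) σ

/-- The memory at the start: `n` and `m` in the registers `0` and `1`, the two endpoints of `e_k`
in the cells `k` of the arrays `0` and `1`, and zeros elsewhere. -/
def input (G : RelationalEventGraph) : Memory where
  reg x := if x = 0 then G.n else if x = 1 then G.m else 0
  arr a k :=
    if h : k < G.m then
      if a = 0 then ((G.edge ⟨k, h⟩).1 : ℕ) else if a = 1 then ((G.edge ⟨k, h⟩).2 : ℕ) else 0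
    else 0

end RAM

/-! ## Reductions to dominance counting -/

/-- A data set for dominance counting, listed without repetition: at most `N` points of the integer
grid with `1 ≤ y ≤ x ≤ N`. -/
structure IsDominanceData (N : ℕ) (P : List (ℕ × ℕ)) : Prop where
  nodup : P.Nodup
  length_le : P.length ≤ N
  mem_grid : ∀ p ∈ P, 1 ≤ p.2 ∧ p.2 ≤ p.1 ∧ p.1 ≤ N

/-- The place of a point set in the memory of the machine: the register with the number of points
and the arrays with their `x`- and `y`-coordinates. -/
structure PointSetLocation where
  countReg : ℕ
  xArr : ℕ
  yArr : ℕ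

def PointSetLocation.points (L : PointSetLocation) (σ : RAM.Memory) : List (ℕ × ℕ) :=
  (List.range (σ.reg L.countReg)).map fun t => (σ.arr L.xArr t, σ.arr L.yArr t)

/-- One of the four quadrants at a query point `(x₀, y₀)`: `x ≤ x₀` if `left` holds and `x₀ ≤ x`
otherwise, `y ≤ y₀` if `below` holds and `y₀ ≤ y` otherwise. -/
structure Quadrant where
  left : Bool
  below : Bool

/-- The dominance counting query: the number of points in a quadrant at `(x₀, y₀)`. -/
def dominanceCount (P : List (ℕ × ℕ)) (q : Quadrant) (x₀ y₀ : ℤ) : ℕ :=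
  P.countP fun p =>
    (if q.left then decide ((p.1 : ℤ) ≤ x₀) else decide (x₀ ≤ (p.1 : ℤ))) &&
    (if q.below then decide ((p.2 : ℤ) ≤ y₀) else decide (y₀ ≤ (p.2 : ℤ)))

/-- A form `cn * n + cm * m + ci * i + cj * j + c` with integer coefficients. -/
structure AffineForm where
  cn : ℤ
  cm : ℤ
  ci : ℤ
  cj : ℤ
  c : ℤ

def AffineForm.eval (f : AffineForm) (n m i j : ℕ) : ℤ :=
  f.cn * n + f.cm * m + f.ci * i + f.cj * j + f.c

/-- One dominance counting query made for a slice query: the point set that is queried, the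
quadrant, the query point in terms of the slice, and the coefficient of the count. -/
structure DominanceQuery where
  coeff : ℤ
  source : PointSetLocation
  quadrant : Quadrant
  x : AffineForm
  y : AffineForm

/-- A scheme for answering slice queries: a fixed list of dominance counting queries, whose counts
are combined linearly and added to an affine form in `n`, `m`, `i`, `j`. -/
structure QueryScheme where
  base : AffineForm
  queries : List DominanceQuery

/-- The answer to the slice query `(i, j)`, from the point sets in the memory `σ`. -/
def QueryScheme.answer (s : QueryScheme) (σ : RAM.Memory) (n m i j : ℕ) : ℤ :=
  s.base.eval n m i j +
    (s.queries.map fun d => d.coeff *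
      (dominanceCount (d.source.points σ) d.quadrant (d.x.eval n m i j) (d.y.eval n m i j) : ℤ)).sum

/-- The problem of determining the quantity `f H` for the slices `H = G_{i,j}` of a relational event
graph `G` can be reduced to dominance counting in time `O(time n m)` and space `O(space n m)`: a
program of the random access machine, with words of `log (n + m) + O(1)` bits, computes from every
`G` point sets with `O(1)` points per edge, such that each slice query is answered by a constant
number of dominance counting queries on them. The program, the scheme of the queries and the
constant `C` are the same for all `G`. -/
def ReducesToDominanceCounting (f : ∀ {n m : ℕ}, Graph (Fin n) (Fin m) → ℕ)
    (time space : ℕ → ℕ → ℕ) : Prop :=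
  ∃ (p : RAM.Program) (s : QueryScheme) (C : ℕ), ∀ G : RelationalEventGraph,
    ∃ (t : ℕ) (σ : RAM.Memory),
      RAM.Run (C * (G.n + G.m + 1)) (C * space G.n G.m) p (RAM.input G) t σ ∧
      t ≤ C * time G.n G.m ∧
      (∀ d ∈ s.queries, ∃ N ≤ C * G.m, IsDominanceData N (d.source.points σ)) ∧
      ∀ i j : ℕ, i ≤ j → j < G.m → (f (G.slice i j) : ℤ) = s.answer σ G.n G.m i j

/-! ## Connection by heavy edges -/

section JoinClasses

variable {α : Type*}

/-- The equivalence relation that arises from `s` by joining the classes of `u` and `v`. -/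
def joinClasses (s : Setoid α) (u v : α) : Setoid α where
  r a b := s a b ∨ s a u ∧ s v b ∨ s a v ∧ s u b
  iseqv :=
    { refl := fun a => .inl (s.refl' a)
      symm := by
        rintro a b (h | ⟨h, h'⟩ | ⟨h, h'⟩)
        exacts [.inl (s.symm' h), .inr (.inr ⟨s.symm' h', s.symm' h⟩),
          .inr (.inl ⟨s.symm' h', s.symm' h⟩)]
      trans := by
        rintro a b c (h | ⟨h, h'⟩ | ⟨h, h'⟩) (k | ⟨k, k'⟩ | ⟨k, k'⟩)
        exacts [.inl (s.trans' h k), .inr (.inl ⟨s.trans' h k, k'⟩),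
          .inr (.inr ⟨s.trans' h k, k'⟩), .inr (.inl ⟨h, s.trans' h' k⟩),
          .inl (s.trans' h (s.trans' (s.symm' k) (s.trans' (s.symm' h') k'))),
          .inl (s.trans' h k'), .inr (.inr ⟨h, s.trans' h' k⟩), .inl (s.trans' h k'),
          .inl (s.trans' h (s.trans' (s.symm' k) (s.trans' (s.symm' h') k')))] }

theorem joinClasses_le_iff {s t : Setoid α} {u v : α} :
    joinClasses s u v ≤ t ↔ s ≤ t ∧ t u v := by
  refine ⟨fun h => ⟨fun _ _ hab => h (.inl hab), h (.inr (.inl ⟨s.refl' u, s.refl' v⟩))⟩, ?_⟩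
  rintro ⟨hst, huv⟩ a b (h | ⟨h, h'⟩ | ⟨h, h'⟩)
  exacts [hst h, t.trans' (hst h) (t.trans' huv (hst h')),
    t.trans' (hst h) (t.trans' (t.symm' huv) (hst h'))]

theorem joinClasses_eq_self {s : Setoid α} {u v : α} (h : s u v) : joinClasses s u v = s :=
  le_antisymm (joinClasses_le_iff.2 ⟨le_rfl, h⟩) (joinClasses_le_iff.1 le_rfl).1

theorem card_quotient_joinClasses_add_one [Finite α] {s : Setoid α} {u v : α} (h : ¬ s u v) :
    Nat.card (Quotient (joinClasses s u v)) + 1 = Nat.card (Quotient s) := by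
  classical
  let toJoin (c : {c : Quotient s // c ≠ ⟦v⟧}) : Quotient (joinClasses s u v) :=
    c.1.map id fun _ _ => .inl
  have toJoin_bijective : Function.Bijective toJoin := by
    constructor
    · rintro ⟨⟨a⟩, ha⟩ ⟨⟨b⟩, hb⟩ hab
      have hav : ¬ s a v := fun hs => ha (Quotient.sound hs)
      have hbv : ¬ s b v := fun hs => hb (Quotient.sound hs)
      rcases Quotient.exact hab with hs | ⟨-, hs⟩ | ⟨hs, -⟩
      exacts [Subtype.ext (Quotient.sound hs), absurd (s.symm' hs) hbv, absurd hs hav]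
    · rintro ⟨a⟩
      by_cases ha : s a v
      · exact ⟨⟨⟦u⟧, fun huv => h (Quotient.exact huv)⟩,
          Quotient.sound (.inr (.inl ⟨s.refl' u, s.symm' ha⟩))⟩
      · exact ⟨⟨⟦a⟧, fun hav => ha (Quotient.exact hav)⟩, rfl⟩
  rw [← Nat.card_eq_of_bijective toJoin toJoin_bijective, ← Finite.card_option,
    Nat.card_congr (Equiv.optionSubtypeNe _)]

end JoinClasses

/-- An edge from `fst` to `snd` with a weight. -/
structure WeightedEdge (α : Type*) where
  fst : α
  snd : α
  weight : ℕ

namespace WeightedEdge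

variable {α β : Type*}

/-- The edge between the images of the endpoints. -/
def map (f : α → β) (e : WeightedEdge α) : WeightedEdge β := ⟨f e.fst, f e.snd, e.weight⟩

/-- Connection by the edges of weight at least `θ`. -/
def connected (E : List (WeightedEdge α)) (θ : ℕ) : Setoid α :=
  Relation.EqvGen.setoid fun a b => ∃ e ∈ E, e.fst = a ∧ e.snd = b ∧ θ ≤ e.weight

variable {E : List (WeightedEdge α)} {e : WeightedEdge α} {θ : ℕ}

theorem connected_le_iff {s : Setoid α} :
    connected E θ ≤ s ↔ ∀ e ∈ E, θ ≤ e.weight → s e.fst e.snd := by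
  refine ⟨fun h e he hθ => h (.rel _ _ ⟨e, he, rfl, rfl, hθ⟩), fun h => Setoid.eqvGen_le ?_⟩
  rintro _ _ ⟨e, he, rfl, rfl, hθ⟩
  exact h e he hθ

theorem connected_of_mem (he : e ∈ E) (hθ : θ ≤ e.weight) : connected E θ e.fst e.snd :=
  connected_le_iff.1 le_rfl e he hθ

theorem connected_antitone : Antitone (connected E) := fun _ _ h =>
  connected_le_iff.2 fun _ he hθ => connected_of_mem he (h.trans hθ)

@[simp]
theorem connected_nil : connected ([] : List (WeightedEdge α)) θ = ⊥ :=
  le_bot_iff.1 (connected_le_iff.2 (by simp))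

theorem connected_cons_of_le (hθ : θ ≤ e.weight) :
    connected (e :: E) θ = joinClasses (connected E θ) e.fst e.snd := by
  apply eq_of_forall_ge_iff
  simp [connected_le_iff, joinClasses_le_iff, hθ, and_comm]

theorem connected_cons_of_lt (hθ : e.weight < θ) : connected (e :: E) θ = connected E θ := by
  apply eq_of_forall_ge_iff
  simp [connected_le_iff, hθ.not_ge]

theorem connected_map_of_connected (f : α → β) {a b : α} (h : connected E θ a b) :
    connected (E.map (map f)) θ (f a) (f b) := by
  have hle : connected E θ ≤ (connected (E.map (map f)) θ).comap f :=
    connected_le_iff.2 fun e he hθ =>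
      connected_of_mem (e := map f e) (List.mem_map_of_mem he) hθ
  exact hle h

theorem connected_map_iff {f : α → β} (hf : Function.Injective f) {a b : α} :
    connected (E.map (map f)) θ (f a) (f b) ↔ connected E θ a b := by
  refine ⟨fun h => ?_, connected_map_of_connected f⟩
  have : Nonempty α := ⟨a⟩
  have hinv := Function.leftInverse_invFun hf
  have h' := connected_map_of_connected (Function.invFun f) h
  rwa [hinv, hinv, List.map_map, List.map_congr_left (g := id), List.map_id] at h'
  intro e _
  simp [map, hinv e.fst, hinv e.snd]

open Classical in
/-- The weight of the edge that becomes superfluous when `e` is added to `E`: the lightest edge of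
the cycle that `e` closes in a maximum spanning forest of `E`, or `0` if it closes none. -/
noncomputable def superfluousWeight (E : List (WeightedEdge α)) (e : WeightedEdge α) : ℕ :=
  Nat.findGreatest (fun θ => connected E θ e.fst e.snd) e.weight

theorem superfluousWeight_le : superfluousWeight E e ≤ e.weight :=
  open Classical in Nat.findGreatest_le _

theorem le_superfluousWeight_iff (hθ : 1 ≤ θ) :
    θ ≤ superfluousWeight E e ↔ θ ≤ e.weight ∧ connected E θ e.fst e.snd := by
  classical
  refine ⟨fun h => ⟨h.trans superfluousWeight_le, ?_⟩, fun ⟨h, h'⟩ => Nat.le_findGreatest h h'⟩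
  have hne : superfluousWeight E e ≠ 0 := by omega
  exact connected_antitone h (Nat.findGreatest_of_ne_zero rfl hne)

theorem eq_superfluousWeight {r : ℕ}
    (h : ∀ θ, 1 ≤ θ → (θ ≤ r ↔ θ ≤ e.weight ∧ connected E θ e.fst e.snd)) :
    r = superfluousWeight E e := by
  refine eq_of_forall_le_iff fun θ => ?_
  rcases Nat.eq_zero_or_pos θ with rfl | hθ
  · simp
  · rw [h θ hθ, le_superfluousWeight_iff hθ]

theorem connected_cons_of_fst_eq_snd (h : e.fst = e.snd) :
    connected (e :: E) θ = connected E θ := by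
  apply eq_of_forall_ge_iff
  simp [connected_le_iff, h]

theorem superfluousWeight_of_fst_eq_snd (h : e.fst = e.snd) : superfluousWeight E e = e.weight :=
  (eq_superfluousWeight fun θ _ => by simp [h]).symm

theorem superfluousWeight_map {f : α → β} (hf : Function.Injective f) :
    superfluousWeight (E.map (map f)) (e.map f) = superfluousWeight E e :=
  eq_superfluousWeight fun θ hθ => by
    rw [le_superfluousWeight_iff hθ]
    exact and_congr_right' (connected_map_iff hf)

theorem card_quotient_connected_nil :
    Nat.card (Quotient (connected ([] : List (WeightedEdge α)) θ)) = Nat.card α := by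
  rw [connected_nil]
  exact Nat.card_congr Setoid.quotientBotEquiv

theorem card_quotient_connected_cons [Finite α] (E : List (WeightedEdge α)) (e : WeightedEdge α)
    (hθ : 1 ≤ θ) :
    Nat.card (Quotient (connected (e :: E) θ)) + (if θ ≤ e.weight then 1 else 0) =
      Nat.card (Quotient (connected E θ)) + (if θ ≤ superfluousWeight E e then 1 else 0) := by
  have hiff := le_superfluousWeight_iff (E := E) (e := e) hθ
  rcases lt_or_ge e.weight θ with hlt | hle
  · rw [connected_cons_of_lt hlt, if_neg hlt.not_ge, if_neg fun h => hlt.not_ge (hiff.1 h).1]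
  rw [connected_cons_of_le hle, if_pos hle]
  by_cases huv : connected E θ e.fst e.snd
  · rw [joinClasses_eq_self huv, if_pos (hiff.2 ⟨hle, huv⟩)]
  · rw [if_neg fun h => huv (hiff.1 h).2, card_quotient_joinClasses_add_one huv, add_zero]

end WeightedEdge

theorem add_one_sub_eq_sub_add_ite (i j : ℕ) :
    j + 1 - i = j - i + if i + 1 ≤ j + 1 then 1 else 0 := by
  split_ifs <;> omega

/-- A sequence of edges on a type with a distinguished element `root`. The edge number `k` has the
weight `k + 1`, so that the edges since the time `i` are those of weight at least `i + 1`. -/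
structure RootedEdgeSequence (α : Type*) where
  root : α
  fst : ℕ → α
  snd : ℕ → α

namespace RootedEdgeSequence

open WeightedEdge

variable {α β : Type*} (q : RootedEdgeSequence α) (k : ℕ)

/-- The sequence of the images of the edges. -/
def map (f : α → β) : RootedEdgeSequence β := ⟨f q.root, f ∘ q.fst, f ∘ q.snd⟩

/-- The edge number `k`. -/
def edge : WeightedEdge α := ⟨q.fst k, q.snd k, k + 1⟩

/-- The first `k` edges, the last one first. -/
def forestEdges : ℕ → List (WeightedEdge α)
  | 0 => []
  | k + 1 => q.edge k :: forestEdges k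

/-- The greatest weight `θ` such that the edge number `k` closes a cycle with earlier edges of
weight at least `θ`. -/
noncomputable def cycleWeight : ℕ := superfluousWeight (q.forestEdges k) (q.edge k)

/-- The edge that records at the root that the edge number `k` has closed a cycle. -/
noncomputable def loopEdge : WeightedEdge α := ⟨q.fst k, q.root, q.cycleWeight k⟩

/-- The first `k` edges, and an edge to the root for every cycle that they close: a vertex is
connected to the root if its component contains a cycle. -/
noncomputable def loopEdges : ℕ → List (WeightedEdge α)
  | 0 => []
  | k + 1 => q.loopEdge k :: q.edge k :: loopEdges k

/-- The edge from the first endpoint of the edge number `k` to the root. -/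
def fstTouchEdge : WeightedEdge α := ⟨q.fst k, q.root, k + 1⟩

/-- The edge from the second endpoint of the edge number `k` to the root. -/
def sndTouchEdge : WeightedEdge α := ⟨q.snd k, q.root, k + 1⟩

/-- The edges to the root from the endpoints of the first `k` edges. -/
def touchEdges : ℕ → List (WeightedEdge α)
  | 0 => []
  | k + 1 => q.sndTouchEdge k :: q.fstTouchEdge k :: touchEdges k

/-- The superfluous weights of `forestEdges` (index `0`), of the two edges that enter `loopEdges` in
each step (indices `1` and `2`), and of the two edges that enter `touchEdges` (`3` and `4`). -/
noncomputable def recordedWeight : ℕ → ℕ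
  | 0 => q.cycleWeight k
  | 1 => superfluousWeight (q.loopEdges k) (q.edge k)
  | 2 => superfluousWeight (q.edge k :: q.loopEdges k) (q.loopEdge k)
  | 3 => superfluousWeight (q.touchEdges k) (q.fstTouchEdge k)
  | _ => superfluousWeight (q.fstTouchEdge k :: q.touchEdges k) (q.sndTouchEdge k)

theorem mem_forestEdges {e : WeightedEdge α} : e ∈ q.forestEdges k ↔ ∃ l < k, e = q.edge l := by
  induction k with
  | zero => simp [forestEdges]
  | succ k ih => rw [forestEdges, List.mem_cons, ih, Nat.exists_lt_succ_right, or_comm]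

theorem mem_loopEdges {e : WeightedEdge α} :
    e ∈ q.loopEdges k ↔ ∃ l < k, e = q.loopEdge l ∨ e = q.edge l := by
  induction k with
  | zero => simp [loopEdges]
  | succ k ih =>
    rw [loopEdges, List.mem_cons, List.mem_cons, ih, Nat.exists_lt_succ_right, ← or_assoc, or_comm]

theorem mem_touchEdges {e : WeightedEdge α} :
    e ∈ q.touchEdges k ↔ ∃ l < k, e = q.sndTouchEdge l ∨ e = q.fstTouchEdge l := by
  induction k with
  | zero => simp [touchEdges]
  | succ k ih =>
    rw [touchEdges, List.mem_cons, List.mem_cons, ih, Nat.exists_lt_succ_right, ← or_assoc, or_comm]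

theorem recordedWeight_le (t : ℕ) : q.recordedWeight k t ≤ k + 1 := by
  have hcycle : q.cycleWeight k ≤ k + 1 := superfluousWeight_le
  match t with
  | 0 => exact hcycle
  | 1 => exact superfluousWeight_le
  | 2 => exact superfluousWeight_le.trans hcycle
  | 3 => exact superfluousWeight_le
  | _ + 4 => exact superfluousWeight_le

section Map

variable {q} {f : α → β}

theorem forestEdges_map (f : α → β) (k : ℕ) :
    (q.map f).forestEdges k = (q.forestEdges k).map (WeightedEdge.map f) := by
  induction k with
  | zero => rfl
  | succ k ih => rw [forestEdges, ih]; rfl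

theorem cycleWeight_map (hf : Function.Injective f) (k : ℕ) :
    (q.map f).cycleWeight k = q.cycleWeight k := by
  rw [cycleWeight, forestEdges_map]
  exact superfluousWeight_map (e := q.edge k) hf

theorem loopEdge_map (hf : Function.Injective f) (k : ℕ) :
    (q.map f).loopEdge k = (q.loopEdge k).map f := by
  rw [loopEdge, cycleWeight_map hf]; rfl

theorem loopEdges_map (hf : Function.Injective f) (k : ℕ) :
    (q.map f).loopEdges k = (q.loopEdges k).map (WeightedEdge.map f) := by
  induction k with
  | zero => rfl
  | succ k ih => rw [loopEdges, ih, loopEdge_map hf]; rfl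

theorem touchEdges_map (f : α → β) (k : ℕ) :
    (q.map f).touchEdges k = (q.touchEdges k).map (WeightedEdge.map f) := by
  induction k with
  | zero => rfl
  | succ k ih => rw [touchEdges, ih]; rfl

theorem recordedWeight_map (hf : Function.Injective f) (k t : ℕ) :
    (q.map f).recordedWeight k t = q.recordedWeight k t := by
  match t with
  | 0 => exact cycleWeight_map hf k
  | 1 =>
    rw [recordedWeight, loopEdges_map hf]
    exact superfluousWeight_map (e := q.edge k) hf
  | 2 =>
    rw [recordedWeight, loopEdges_map hf, loopEdge_map hf]
    exact superfluousWeight_map (E := q.edge k :: q.loopEdges k) hf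
  | 3 =>
    rw [recordedWeight, touchEdges_map]
    exact superfluousWeight_map (e := q.fstTouchEdge k) hf
  | t + 4 =>
    simp only [recordedWeight, touchEdges_map]
    exact superfluousWeight_map (E := q.fstTouchEdge k :: q.touchEdges k)
      (e := q.sndTouchEdge k) hf

end Map

section Card

variable [Finite α] (i j : ℕ)

theorem card_quotient_forestEdges :
    Nat.card (Quotient (connected (q.forestEdges j) (i + 1))) + (j - i) =
      Nat.card α + Nat.count (i + 1 ≤ q.recordedWeight · 0) j := by
  induction j with
  | zero => simp [forestEdges, card_quotient_connected_nil, -connected_nil]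
  | succ j ih =>
    have hedge := card_quotient_connected_cons (q.forestEdges j) (q.edge j) (Nat.le_add_left 1 i)
    rw [show (q.edge j).weight = j + 1 from rfl] at hedge
    simp only [forestEdges, Nat.count_succ, recordedWeight, cycleWeight] at ih ⊢
    rw [add_one_sub_eq_sub_add_ite]
    omega

theorem card_quotient_loopEdges :
    Nat.card (Quotient (connected (q.loopEdges j) (i + 1))) +
        ((j - i) + Nat.count (i + 1 ≤ q.recordedWeight · 0) j) =
      Nat.card α + (Nat.count (i + 1 ≤ q.recordedWeight · 1) j +
        Nat.count (i + 1 ≤ q.recordedWeight · 2) j) := by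
  induction j with
  | zero => simp [loopEdges, card_quotient_connected_nil, -connected_nil]
  | succ j ih =>
    have hedge := card_quotient_connected_cons (q.loopEdges j) (q.edge j) (Nat.le_add_left 1 i)
    have hloop := card_quotient_connected_cons (q.edge j :: q.loopEdges j) (q.loopEdge j)
      (Nat.le_add_left 1 i)
    rw [show (q.edge j).weight = j + 1 from rfl] at hedge
    rw [show (q.loopEdge j).weight = q.cycleWeight j from rfl] at hloop
    simp only [loopEdges, Nat.count_succ, recordedWeight] at ih ⊢
    rw [add_one_sub_eq_sub_add_ite]
    omega

theorem card_quotient_touchEdges :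
    Nat.card (Quotient (connected (q.touchEdges j) (i + 1))) + 2 * (j - i) =
      Nat.card α + (Nat.count (i + 1 ≤ q.recordedWeight · 3) j +
        Nat.count (i + 1 ≤ q.recordedWeight · 4) j) := by
  induction j with
  | zero => simp [touchEdges, card_quotient_connected_nil, -connected_nil]
  | succ j ih =>
    have hfst := card_quotient_connected_cons (q.touchEdges j) (q.fstTouchEdge j)
      (Nat.le_add_left 1 i)
    have hsnd := card_quotient_connected_cons (q.fstTouchEdge j :: q.touchEdges j)
      (q.sndTouchEdge j) (Nat.le_add_left 1 i)
    rw [show (q.fstTouchEdge j).weight = j + 1 from rfl] at hfst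
    rw [show (q.sndTouchEdge j).weight = j + 1 from rfl] at hsnd
    simp only [touchEdges, Nat.count_succ, recordedWeight] at ih ⊢
    rw [add_one_sub_eq_sub_add_ite]
    omega

end Card

end RootedEdgeSequence

namespace RelationalEventGraph

variable (G : RelationalEventGraph)

/-- The edges of `G` on the vertices of `G` and a root. There is a loop at the root for every number
that is not the number of an edge. -/
def rootedEdges : RootedEdgeSequence (Option (Fin G.n)) where
  root := none
  fst k := if hk : k < G.m then some (G.edge ⟨k, hk⟩).1 else none
  snd k := if hk : k < G.m then some (G.edge ⟨k, hk⟩).2 else none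

variable {G}

theorem rootedEdges_fst (k : Fin G.m) : G.rootedEdges.fst k = some (G.edge k).1 := dif_pos k.2

theorem rootedEdges_snd (k : Fin G.m) : G.rootedEdges.snd k = some (G.edge k).2 := dif_pos k.2

theorem rootedEdges_edge (k : Fin G.m) :
    G.rootedEdges.edge k = ⟨some (G.edge k).1, some (G.edge k).2, k + 1⟩ := by
  rw [RootedEdgeSequence.edge, rootedEdges_fst, rootedEdges_snd]

end RelationalEventGraph

/-! ## Bottleneck trees -/

theorem sum_add_of_eqOn_compl_pair {V : Finset ℕ} {f g : ℕ → ℕ} {x y : ℕ} (hx : x ∈ V)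
    (hy : y ∈ V) (hxy : x ≠ y) (h : ∀ t, t ≠ x → t ≠ y → f t = g t) :
    ∑ t ∈ V, f t + (g x + g y) = ∑ t ∈ V, g t + (f x + f y) := by
  have hy' : y ∈ V.erase x := Finset.mem_erase.2 ⟨hxy.symm, hy⟩
  rw [← Finset.add_sum_erase V f hx, ← Finset.add_sum_erase V g hx,
    ← Finset.add_sum_erase _ f hy', ← Finset.add_sum_erase _ g hy',
    Finset.sum_congr rfl fun t ht => h t (by grind) (by grind)]
  ring

theorem log_two_add_one_le {a b : ℕ} (ha : 0 < a) (h : 2 * a ≤ b) :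
    Nat.log 2 a + 1 ≤ Nat.log 2 b := by
  rw [← Nat.log_mul_base one_lt_two ha.ne']
  exact Nat.log_mono_right (by omega)

/-- A tree with root `0`: the parent of a vertex, the weight of the edge from the vertex to its
parent, and the number of proper descendants of the vertex. -/
structure BottleneckTree where
  parent : ℕ → ℕ
  weight : ℕ → ℕ
  descendants : ℕ → ℕ

namespace BottleneckTree

/-- The vertices other than the root are `1, …, N`, and the weights are at most `B`. The conditions
on the numbers of descendants exclude cycles. -/
structure WellFormed (N B : ℕ) (T : BottleneckTree) : Prop where
  parent_zero : T.parent 0 = 0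
  parent_le : ∀ x ∈ Finset.Icc 1 N, T.parent x ≤ N
  weight_le : ∀ x ∈ Finset.Icc 1 N, T.weight x ≤ B
  descendants_lt : ∀ x ∈ Finset.Icc 1 N, T.descendants x < N
  descendants_eq : ∀ x ∈ Finset.Icc 1 N, T.descendants x =
    ∑ y ∈ Finset.Icc 1 N, if T.parent y = x then T.descendants y + 1 else 0

/-- Connection by the edges of weight at least `θ` of the tree. -/
def connected (N : ℕ) (T : BottleneckTree) (θ : ℕ) : Setoid ℕ :=
  WeightedEdge.connected ((List.range' 1 N).map fun x => ⟨x, T.parent x, T.weight x⟩) θ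

/-- The sum of the logarithms of the sizes of the subtrees, for the amortized analysis. -/
def potential (N : ℕ) (T : BottleneckTree) : ℕ :=
  ∑ x ∈ Finset.Icc 1 N, Nat.log 2 (T.descendants x + 1)

/-- Hang `x` from its grandparent. -/
def shortcut (T : BottleneckTree) (x : ℕ) : BottleneckTree where
  parent := Function.update T.parent x (T.parent (T.parent x))
  weight := T.weight
  descendants := Function.update T.descendants (T.parent x)
    (T.descendants (T.parent x) - (T.descendants x + 1))

/-- Exchange `x` and its parent, together with the weights of the edges above them. -/
def rotate (T : BottleneckTree) (x : ℕ) : BottleneckTree where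
  parent := Function.update (Function.update T.parent (T.parent x) x) x (T.parent (T.parent x))
  weight := Function.update (Function.update T.weight x (T.weight (T.parent x))) (T.parent x)
    (T.weight x)
  descendants := Function.update (Function.update T.descendants (T.parent x)
    (T.descendants (T.parent x) - (T.descendants x + 1))) x (T.descendants (T.parent x))

/-- Decrease the depth of `x` by one, without changing the connections. -/
def promote (T : BottleneckTree) (x : ℕ) : BottleneckTree :=
  if T.weight (T.parent x) < T.weight x then T.rotate x else T.shortcut x

variable {N B θ : ℕ} {T : BottleneckTree} {x y : ℕ}

theorem connected_le_iff {r : Setoid ℕ} :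
    T.connected N θ ≤ r ↔ ∀ x ∈ Finset.Icc 1 N, θ ≤ T.weight x → r x (T.parent x) := by
  rw [connected, WeightedEdge.connected_le_iff, List.forall_mem_map]
  simp [List.mem_range'_1, Nat.lt_one_add_iff]

theorem connected_of_parent_eq (hx : x ∈ Finset.Icc 1 N) (hp : T.parent x = y)
    (hw : θ ≤ T.weight x) : T.connected N θ x y :=
  hp ▸ connected_le_iff.1 le_rfl x hx hw

/-! ### Promotion -/

theorem parent_promote_self (T : BottleneckTree) (x : ℕ) :
    (T.promote x).parent x = T.parent (T.parent x) := by
  unfold promote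
  split_ifs <;> simp [rotate, shortcut]

theorem parent_promote_of_ne (T : BottleneckTree) {x t : ℕ} (h : t ≠ x) (h' : t ≠ T.parent x) :
    (T.promote x).parent t = T.parent t := by
  unfold promote
  split_ifs <;> simp [rotate, shortcut, h, h']

theorem descendants_promote_of_ne (T : BottleneckTree) {x t : ℕ} (h : t ≠ x)
    (h' : t ≠ T.parent x) : (T.promote x).descendants t = T.descendants t := by
  unfold promote
  split_ifs <;> simp [rotate, shortcut, h, h']

theorem descendants_promote_parent (T : BottleneckTree) (h : T.parent x ≠ x) :
    (T.promote x).descendants (T.parent x) =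
      T.descendants (T.parent x) - (T.descendants x + 1) := by
  unfold promote
  split_ifs <;> simp [rotate, shortcut, h]

namespace WellFormed

theorem parent_mem (h : T.WellFormed N B) (hx : x ∈ Finset.Icc 1 N) (hp : T.parent x ≠ 0) :
    T.parent x ∈ Finset.Icc 1 N :=
  Finset.mem_Icc.2 ⟨by omega, h.parent_le x hx⟩

theorem descendants_lt_parent (h : T.WellFormed N B) (hx : x ∈ Finset.Icc 1 N)
    (hp : T.parent x ≠ 0) : T.descendants x < T.descendants (T.parent x) := by
  have hle := Finset.single_le_sum
    (f := fun y => if T.parent y = T.parent x then T.descendants y + 1 else 0)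
    (fun _ _ => Nat.zero_le _) hx
  rwa [← h.descendants_eq _ (h.parent_mem hx hp), if_pos rfl] at hle

theorem parent_iterate_succ_eq_zero_or (h : T.WellFormed N B) (hx : x ∈ Finset.Icc 1 N) (k : ℕ) :
    T.parent^[k + 1] x = 0 ∨ T.parent^[k + 1] x ∈ Finset.Icc 1 N ∧
      T.descendants x < T.descendants (T.parent^[k + 1] x) := by
  induction k with
  | zero =>
    exact or_iff_not_imp_left.2 fun hp => ⟨h.parent_mem hx hp, h.descendants_lt_parent hx hp⟩
  | succ k ih =>
    rw [Function.iterate_succ_apply']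
    rcases ih with hzero | ⟨hmem, hlt⟩
    · exact .inl (hzero ▸ h.parent_zero)
    · exact or_iff_not_imp_left.2 fun hp =>
        ⟨h.parent_mem hmem hp, hlt.trans (h.descendants_lt_parent hmem hp)⟩

theorem parent_iterate_succ_ne (h : T.WellFormed N B) (hx : x ∈ Finset.Icc 1 N) (k : ℕ) :
    T.parent^[k + 1] x ≠ x := by
  intro hcycle
  rcases h.parent_iterate_succ_eq_zero_or hx k with hzero | ⟨-, hlt⟩
  · have := (Finset.mem_Icc.1 hx).1
    omega
  · exact hlt.ne (congrArg _ hcycle.symm)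

theorem parent_ne (h : T.WellFormed N B) (hx : x ∈ Finset.Icc 1 N) : T.parent x ≠ x :=
  h.parent_iterate_succ_ne hx 0

theorem parent_parent_ne (h : T.WellFormed N B) (hx : x ∈ Finset.Icc 1 N) :
    T.parent (T.parent x) ≠ x :=
  h.parent_iterate_succ_ne hx 1

/-- The descendants of `x` are separated from the other vertices by the edge above `x`. -/
theorem connected_parent_iff (h : T.WellFormed N B) (hx : x ∈ Finset.Icc 1 N) :
    T.connected N θ x (T.parent x) ↔ θ ≤ T.weight x := by
  refine ⟨fun hconn => ?_, connected_of_parent_eq hx rfl⟩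
  by_contra hw
  have hle : T.connected N θ ≤ Setoid.ker fun y => ∃ k, T.parent^[k] y = x := by
    refine connected_le_iff.2 fun t _ ht => propext ⟨?_, fun ⟨k, hk⟩ => ⟨k + 1, hk⟩⟩
    rintro ⟨_ | k, hk⟩
    exacts [absurd (hk ▸ ht) hw, ⟨k, hk⟩]
  obtain ⟨k, hk⟩ := (hle hconn : (∃ k, T.parent^[k] x = x) = _).mp ⟨0, rfl⟩
  exact h.parent_iterate_succ_ne hx k hk

section Promote

variable (h : T.WellFormed N B) (hx : x ∈ Finset.Icc 1 N) (hp : T.parent x ≠ 0)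
include h hx hp

theorem shortcut : (T.shortcut x).WellFormed N B := by
  have hy := h.parent_mem hx hp
  have hyx := h.parent_ne hx
  have := h.parent_parent_ne hx
  have hzy := h.parent_ne hy
  have hs := h.descendants_lt_parent hx hp
  have hx0 : 0 < x := (Finset.mem_Icc.1 hx).1
  refine ⟨?_, fun t ht => ?_, h.weight_le, fun t ht => ?_, fun t ht => ?_⟩
  · simp [BottleneckTree.shortcut, h.parent_zero, hx0.ne]
  · have := h.parent_le t ht
    have := h.parent_le _ hy
    simp only [BottleneckTree.shortcut, Function.update_apply]
    split_ifs <;> omega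
  · have := h.descendants_lt t ht
    have := h.descendants_lt _ hy
    simp only [BottleneckTree.shortcut, Function.update_apply]
    split_ifs <;> omega
  · have hold := h.descendants_eq t ht
    have hnew := sum_add_of_eqOn_compl_pair
      (f := fun y => if (T.shortcut x).parent y = t then (T.shortcut x).descendants y + 1 else 0)
      (g := fun y => if T.parent y = t then T.descendants y + 1 else 0) hx hy hyx.symm
      (fun u hu hu' => by simp [BottleneckTree.shortcut, hu, hu'])
    simp only [BottleneckTree.shortcut, Function.update_apply] at hnew ⊢
    grind

theorem rotate : (T.rotate x).WellFormed N B := by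
  have hy := h.parent_mem hx hp
  have hyx := h.parent_ne hx
  have := h.parent_parent_ne hx
  have := h.parent_ne hy
  have hs := h.descendants_lt_parent hx hp
  have hxN := Finset.mem_Icc.1 hx
  refine ⟨?_, fun t ht => ?_, fun t ht => ?_, fun t ht => ?_, fun t ht => ?_⟩
  · simp [BottleneckTree.rotate, h.parent_zero, hp.symm, (Nat.one_le_iff_ne_zero.1 hxN.1).symm]
  · have := h.parent_le t ht
    have := h.parent_le _ hy
    simp only [BottleneckTree.rotate, Function.update_apply]
    split_ifs <;> omega
  · have := h.weight_le t ht
    have := h.weight_le _ hy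
    have := h.weight_le _ hx
    simp only [BottleneckTree.rotate, Function.update_apply]
    split_ifs <;> omega
  · have := h.descendants_lt t ht
    have := h.descendants_lt _ hy
    simp only [BottleneckTree.rotate, Function.update_apply]
    split_ifs <;> omega
  · have hold := h.descendants_eq t ht
    have hnew := sum_add_of_eqOn_compl_pair
      (f := fun y => if (T.rotate x).parent y = t then (T.rotate x).descendants y + 1 else 0)
      (g := fun y => if T.parent y = t then T.descendants y + 1 else 0) hx hy hyx.symm
      (fun u hu hu' => by simp [BottleneckTree.rotate, hu, hu'])
    simp only [BottleneckTree.rotate, Function.update_apply] at hnew ⊢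
    grind

theorem promote : (T.promote x).WellFormed N B := by
  unfold BottleneckTree.promote
  split_ifs
  exacts [h.rotate hx hp, h.shortcut hx hp]

theorem connected_shortcut (hw : T.weight x ≤ T.weight (T.parent x)) (θ : ℕ) :
    (T.shortcut x).connected N θ = T.connected N θ := by
  have hy := h.parent_mem hx hp
  have hyx := h.parent_ne hx
  have parent_self : (T.shortcut x).parent x = T.parent (T.parent x) := by
    simp [BottleneckTree.shortcut]
  have parent_of_ne {t : ℕ} (ht : t ≠ x) : (T.shortcut x).parent t = T.parent t := by
    simp [BottleneckTree.shortcut, ht]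
  refine le_antisymm (connected_le_iff.2 fun t ht hθ => ?_) (connected_le_iff.2 fun t ht hθ => ?_)
  · rcases eq_or_ne t x with rfl | htx
    · rw [parent_self]
      exact Setoid.trans' _ (connected_of_parent_eq hx rfl hθ)
        (connected_of_parent_eq hy rfl (hθ.trans hw))
    · exact connected_of_parent_eq ht (parent_of_ne htx).symm hθ
  · rcases eq_or_ne t x with rfl | htx
    · exact Setoid.trans' _ (connected_of_parent_eq hx parent_self hθ)
        (Setoid.symm' _ (connected_of_parent_eq hy (parent_of_ne hyx) (hθ.trans hw)))
    · exact connected_of_parent_eq ht (parent_of_ne htx) hθ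

theorem connected_rotate (hw : T.weight (T.parent x) < T.weight x) (θ : ℕ) :
    (T.rotate x).connected N θ = T.connected N θ := by
  have hy := h.parent_mem hx hp
  have hyx := h.parent_ne hx
  have parent_self : (T.rotate x).parent x = T.parent (T.parent x) := by
    simp [BottleneckTree.rotate]
  have parent_parent : (T.rotate x).parent (T.parent x) = x := by
    simp [BottleneckTree.rotate, hyx]
  have weight_self : (T.rotate x).weight x = T.weight (T.parent x) := by
    simp [BottleneckTree.rotate, hyx.symm]
  have weight_parent : (T.rotate x).weight (T.parent x) = T.weight x := by
    simp [BottleneckTree.rotate]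
  have of_ne {t : ℕ} (htx : t ≠ x) (hty : t ≠ T.parent x) :
      (T.rotate x).parent t = T.parent t ∧ (T.rotate x).weight t = T.weight t := by
    simp [BottleneckTree.rotate, htx, hty]
  have connected_edge (hθ : θ ≤ T.weight x) : (T.rotate x).connected N θ x (T.parent x) :=
    Setoid.symm' _ (connected_of_parent_eq hy parent_parent (weight_parent ▸ hθ))
  refine le_antisymm (connected_le_iff.2 fun t ht hθ => ?_) (connected_le_iff.2 fun t ht hθ => ?_)
  · rcases eq_or_ne t x with rfl | htx
    · rw [weight_self] at hθ
      rw [parent_self]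
      exact Setoid.trans' _ (connected_of_parent_eq hx rfl (hθ.trans hw.le))
        (connected_of_parent_eq hy rfl hθ)
    rcases eq_or_ne t (T.parent x) with rfl | hty
    · rw [parent_parent]
      exact Setoid.symm' _ (connected_of_parent_eq hx rfl (weight_parent ▸ hθ))
    · exact connected_of_parent_eq ht (of_ne htx hty).1.symm ((of_ne htx hty).2 ▸ hθ)
  · rcases eq_or_ne t x with rfl | htx
    · exact connected_edge hθ
    rcases eq_or_ne t (T.parent x) with rfl | hty
    · exact Setoid.trans' _ (Setoid.symm' _ (connected_edge (hθ.trans hw.le)))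
        (connected_of_parent_eq hx parent_self (weight_self ▸ hθ))
    · exact connected_of_parent_eq ht (of_ne htx hty).1 ((of_ne htx hty).2 ▸ hθ)

theorem connected_promote (θ : ℕ) : (T.promote x).connected N θ = T.connected N θ := by
  unfold BottleneckTree.promote
  split_ifs with hw
  exacts [h.connected_rotate hx hp hw θ, h.connected_shortcut hx hp (not_lt.1 hw) θ]

theorem descendants_promote_mem_Icc :
    (T.promote x).descendants x ∈ Set.Icc (T.descendants x) (T.descendants (T.parent x)) := by
  have hyx := h.parent_ne hx
  have hs := (h.descendants_lt_parent hx hp).le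
  unfold BottleneckTree.promote
  split_ifs
  · simpa [BottleneckTree.rotate] using hs
  · simpa [BottleneckTree.shortcut, hyx.symm] using hs

theorem potential_promote_add :
    (T.promote x).potential N +
        (Nat.log 2 (T.descendants x + 1) + Nat.log 2 (T.descendants (T.parent x) + 1)) =
      T.potential N + (Nat.log 2 ((T.promote x).descendants x + 1) +
        Nat.log 2 (T.descendants (T.parent x) - (T.descendants x + 1) + 1)) := by
  have hyx := h.parent_ne hx
  rw [← descendants_promote_parent T hyx]
  exact sum_add_of_eqOn_compl_pair (f := fun t => Nat.log 2 ((T.promote x).descendants t + 1))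
    (g := fun t => Nat.log 2 (T.descendants t + 1)) hx (h.parent_mem hx hp) hyx.symm
    fun t htx hty => by simp only [descendants_promote_of_ne T htx hty]

theorem potential_promote_le :
    (T.promote x).potential N + Nat.log 2 (T.descendants x + 1) ≤
      T.potential N + Nat.log 2 ((T.promote x).descendants x + 1) := by
  have hbalance := h.potential_promote_add hx hp
  have hlog : Nat.log 2 (T.descendants (T.parent x) - (T.descendants x + 1) + 1) ≤
      Nat.log 2 (T.descendants (T.parent x) + 1) := Nat.log_mono_right (by omega)
  omega

theorem potential_promote_lt
    (hsize : 2 * (T.descendants (T.parent x) + 1) ≤ 3 * (T.descendants x + 1)) :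
    (T.promote x).potential N < T.potential N := by
  have hbalance := h.potential_promote_add hx hp
  have hs := h.descendants_lt_parent hx hp
  have hlog : Nat.log 2 (T.descendants (T.parent x) - (T.descendants x + 1) + 1) + 1 ≤
      Nat.log 2 (T.descendants x + 1) := log_two_add_one_le (by omega) (by omega)
  have hlog' : Nat.log 2 ((T.promote x).descendants x + 1) ≤
      Nat.log 2 (T.descendants (T.parent x) + 1) :=
    Nat.log_mono_right (by have := (h.descendants_promote_mem_Icc hx hp).2; omega)
  omega

end Promote

end WellFormed

/-! ### Amortized analysis -/

/-- The vertex to be promoted next in order to bring `u` to the top: the parent of `u`, if the edge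
above it joins subtrees of similar sizes and does not end in a child of the root, and `u`
otherwise. -/
def nextPromoted (T : BottleneckTree) (u : ℕ) : ℕ :=
  if T.parent (T.parent u) ≠ 0 ∧ T.parent (T.parent (T.parent u)) ≠ 0 ∧
    2 * (T.descendants (T.parent (T.parent u)) + 1) ≤ 3 * (T.descendants (T.parent u) + 1)
  then T.parent u else u

/-- A bound for the number of promotions that bring `u` to the top. A promotion of `u` multiplies
the size of the subtree of its parent by at least `3 / 2`, hence the square of this size by at least
`2`. -/
def credit (N : ℕ) (T : BottleneckTree) (u : ℕ) : ℕ :=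
  T.potential N +
    (if T.parent u = 0 then 0 else if T.parent (T.parent u) = 0 then 1 else
      2 * Nat.log 2 N + 3 - Nat.log 2 ((T.descendants (T.parent u) + 1) ^ 2)) -
    Nat.log 2 (T.descendants u + 1)

variable {u v : ℕ}

theorem log_descendants_le_potential (T : BottleneckTree) (hx : x ∈ Finset.Icc 1 N) :
    Nat.log 2 (T.descendants x + 1) ≤ T.potential N :=
  Finset.single_le_sum (f := fun x => Nat.log 2 (T.descendants x + 1)) (fun _ _ => Nat.zero_le _) hx

theorem credit_le (T : BottleneckTree) (u : ℕ) :
    T.credit N u ≤ T.potential N + 2 * Nat.log 2 N + 3 := by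
  unfold credit
  split_ifs <;> omega

theorem parent_promote_nextPromoted_eq_zero_or (T : BottleneckTree) {u o : ℕ} (hu : T.parent u ≠ 0)
    (ho : T.parent o = 0) :
    (T.promote (T.nextPromoted u)).parent o = 0 ∨
      (T.promote (T.nextPromoted u)).parent o = u ∧
        (T.promote (T.nextPromoted u)).parent u = 0 := by
  unfold nextPromoted
  split_ifs with hc
  · left
    rw [parent_promote_of_ne, ho]
    · rintro rfl
      exact hc.1 ho
    · rintro rfl
      exact hc.2.1 ho
  rcases eq_or_ne o (T.parent u) with rfl | hou
  · have hpu : T.parent u ≠ u := fun h => hu (h ▸ ho)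
    rw [parent_promote_self, ho]
    unfold promote
    split_ifs <;> simp [rotate, shortcut, ho, hpu]
  · left
    rw [parent_promote_of_ne T _ hou, ho]
    rintro rfl
    exact hu ho

namespace WellFormed

theorem nextPromoted_mem (h : T.WellFormed N B) (hu : u ∈ Finset.Icc 1 N) (hp : T.parent u ≠ 0) :
    T.nextPromoted u ∈ Finset.Icc 1 N ∧ T.parent (T.nextPromoted u) ≠ 0 := by
  unfold nextPromoted
  split_ifs with hc
  exacts [⟨h.parent_mem hu hp, hc.1⟩, ⟨hu, hp⟩]

theorem log_descendants_sq_le (h : T.WellFormed N B) (hx : x ∈ Finset.Icc 1 N) :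
    Nat.log 2 ((T.descendants x + 1) ^ 2) ≤ 2 * Nat.log 2 N + 1 := by
  have hlt : T.descendants x + 1 < 2 ^ (Nat.log 2 N + 1) :=
    lt_of_le_of_lt (h.descendants_lt x hx) (Nat.lt_pow_succ_log_self one_lt_two N)
  have hsq : (T.descendants x + 1) ^ 2 < 2 ^ (2 * Nat.log 2 N + 2) := by
    calc (T.descendants x + 1) ^ 2 < (2 ^ (Nat.log 2 N + 1)) ^ 2 :=
          Nat.pow_lt_pow_left hlt two_ne_zero
      _ = 2 ^ (2 * Nat.log 2 N + 2) := by ring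
  exact Nat.lt_succ_iff.1 (Nat.log_lt_of_lt_pow (by positivity) hsq)

theorem potential_le_credit (h : T.WellFormed N B) (hu : u ∈ Finset.Icc 1 N) :
    T.potential N ≤ T.credit N u + Nat.log 2 N := by
  have : Nat.log 2 (T.descendants u + 1) ≤ Nat.log 2 N :=
    Nat.log_mono_right (h.descendants_lt u hu)
  unfold credit
  omega

theorem credit_promote_parent_lt (h : T.WellFormed N B) (hu : u ∈ Finset.Icc 1 N)
    (hy : T.parent u ≠ 0) (hz : T.parent (T.parent u) ≠ 0)
    (ht : T.parent (T.parent (T.parent u)) ≠ 0)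
    (hsize : 2 * (T.descendants (T.parent (T.parent u)) + 1) ≤
      3 * (T.descendants (T.parent u) + 1)) :
    (T.promote (T.parent u)).credit N u < T.credit N u := by
  have hyN := h.parent_mem hu hy
  have hyu := (h.parent_ne hu).symm
  have hzu := (h.parent_parent_ne hu).symm
  have hlog : Nat.log 2 ((T.descendants (T.parent u) + 1) ^ 2) ≤
      Nat.log 2 (((T.promote (T.parent u)).descendants (T.parent u) + 1) ^ 2) :=
    Nat.log_mono_right
      (Nat.pow_le_pow_left (Nat.succ_le_succ (h.descendants_promote_mem_Icc hyN hz).1) 2)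
  have hpotential := h.potential_promote_lt hyN hz hsize
  have hlog_sq := h.log_descendants_sq_le hyN
  have hlog_le := log_descendants_le_potential T hu
  simp only [credit, parent_promote_of_ne T hyu hzu, parent_promote_self,
    descendants_promote_of_ne T hyu hzu, if_neg hy, if_neg hz, if_neg ht]
  omega

theorem credit_promote_self_lt (h : T.WellFormed N B) (hu : u ∈ Finset.Icc 1 N)
    (hy : T.parent u ≠ 0)
    (hsize : T.parent (T.parent u) ≠ 0 → T.parent (T.parent (T.parent u)) ≠ 0 →
      3 * (T.descendants (T.parent u) + 1) < 2 * (T.descendants (T.parent (T.parent u)) + 1)) :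
    (T.promote u).credit N u < T.credit N u := by
  have hzu := h.parent_parent_ne hu
  have hzy := h.parent_ne (h.parent_mem hu hy)
  have hlog_sq := h.log_descendants_sq_le (h.parent_mem hu hy)
  have hlog_le := log_descendants_le_potential T hu
  have hpotential := h.potential_promote_le hu hy
  have hlog_le' := log_descendants_le_potential (T.promote u) hu
  simp only [credit, parent_promote_self, if_neg hy]
  by_cases hz : T.parent (T.parent u) = 0
  · rw [if_pos hz, if_pos hz]
    omega
  rw [if_neg hz, if_neg hz, parent_promote_of_ne T hzu hzy]
  by_cases ht : T.parent (T.parent (T.parent u)) = 0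
  · rw [if_pos ht]
    omega
  · specialize hsize hz ht
    have hgrow : Nat.log 2 ((T.descendants (T.parent u) + 1) ^ 2) + 1 ≤
        Nat.log 2 ((T.descendants (T.parent (T.parent u)) + 1) ^ 2) :=
      log_two_add_one_le (by positivity) (by nlinarith)
    rw [if_neg ht, descendants_promote_of_ne T hzu hzy]
    omega

theorem credit_promote_nextPromoted_lt (h : T.WellFormed N B) (hu : u ∈ Finset.Icc 1 N)
    (hp : T.parent u ≠ 0) : (T.promote (T.nextPromoted u)).credit N u < T.credit N u := by
  unfold nextPromoted
  split_ifs with hc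
  · exact h.credit_promote_parent_lt hu hp hc.1 hc.2.1 hc.2.2
  · exact h.credit_promote_self_lt hu hp fun hz ht => by
      by_contra hsize
      exact hc ⟨hz, ht, not_lt.1 hsize⟩

end WellFormed

/-! ### Insertion of edges -/

/-- Make `u` a child of `v`, where both are children of the root. -/
def nest (T : BottleneckTree) (u v : ℕ) : BottleneckTree where
  parent := Function.update T.parent u v
  weight := T.weight
  descendants := Function.update T.descendants v (T.descendants v + T.descendants u + 1)

/-- Raise the weight of the edge above `u` to at least `c`. -/
def raise (T : BottleneckTree) (u c : ℕ) : BottleneckTree where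
  parent := T.parent
  weight := Function.update T.weight u (max (T.weight u) c)
  descendants := T.descendants

theorem le_weight_raise_iff {c : ℕ} : θ ≤ (T.raise u c).weight x ↔
    θ ≤ T.weight x ∨ x = u ∧ θ ≤ c := by
  rcases eq_or_ne x u with rfl | hxu <;> simp [raise, *]

namespace WellFormed

theorem sum_children_zero (h : T.WellFormed N B) :
    ∑ y ∈ Finset.Icc 1 N, (if T.parent y = 0 then T.descendants y + 1 else 0) = N := by
  have hinner : ∑ x ∈ Finset.Icc 1 N, T.descendants x =
      ∑ y ∈ Finset.Icc 1 N, (if T.parent y = 0 then 0 else T.descendants y + 1) := by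
    rw [Finset.sum_congr rfl h.descendants_eq, Finset.sum_comm]
    refine Finset.sum_congr rfl fun y hy => ?_
    rw [Finset.sum_ite_eq]
    have := h.parent_le y hy
    simp only [Finset.mem_Icc]
    split_ifs <;> first | rfl | omega
  have hsplit : ∑ y ∈ Finset.Icc 1 N, (if T.parent y = 0 then T.descendants y + 1 else 0) +
      ∑ y ∈ Finset.Icc 1 N, (if T.parent y = 0 then 0 else T.descendants y + 1) =
      ∑ y ∈ Finset.Icc 1 N, (T.descendants y + 1) := by
    rw [← Finset.sum_add_distrib]
    exact Finset.sum_congr rfl fun y _ => by split_ifs <;> simp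
  rw [Finset.sum_add_distrib, Finset.sum_const, Nat.card_Icc, smul_eq_mul] at hsplit
  omega

section Nest

variable (h : T.WellFormed N B) (hu : u ∈ Finset.Icc 1 N) (hv : v ∈ Finset.Icc 1 N) (huv : u ≠ v)
  (hpu : T.parent u = 0) (hpv : T.parent v = 0)
include h hu hv huv hpu hpv

theorem descendants_add_descendants_le : T.descendants u + T.descendants v + 2 ≤ N := by
  have hsum := h.sum_children_zero
  rw [← Finset.add_sum_erase _ _ hu, ← Finset.add_sum_erase _ _
    (Finset.mem_erase.2 ⟨huv.symm, hv⟩), if_pos hpu, if_pos hpv] at hsum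
  omega

theorem nest : (T.nest u v).WellFormed N B := by
  have hs := h.descendants_add_descendants_le hu hv huv hpu hpv
  have hvN := Finset.mem_Icc.1 hv
  have hu0 : 0 < u := (Finset.mem_Icc.1 hu).1
  refine ⟨?_, fun t ht => ?_, h.weight_le, fun t ht => ?_, fun t ht => ?_⟩
  · simp [BottleneckTree.nest, h.parent_zero, hu0.ne]
  · have := h.parent_le t ht
    simp only [BottleneckTree.nest, Function.update_apply]
    split_ifs <;> omega
  · have := h.descendants_lt t ht
    simp only [BottleneckTree.nest, Function.update_apply]
    split_ifs <;> omega
  · have hold := h.descendants_eq t ht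
    have htN := Finset.mem_Icc.1 ht
    have hnew := sum_add_of_eqOn_compl_pair
      (f := fun y => if (T.nest u v).parent y = t then (T.nest u v).descendants y + 1 else 0)
      (g := fun y => if T.parent y = t then T.descendants y + 1 else 0) hu hv huv
      (fun u hu hu' => by simp [BottleneckTree.nest, hu, hu'])
    simp only [BottleneckTree.nest, Function.update_apply] at hnew ⊢
    grind

theorem potential_nest_le : (T.nest u v).potential N ≤ T.potential N + Nat.log 2 N := by
  have hs := h.descendants_add_descendants_le hu hv huv hpu hpv
  have hsum := sum_add_of_eqOn_compl_pair
      (f := fun y => Nat.log 2 ((T.nest u v).descendants y + 1))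
      (g := fun y => Nat.log 2 (T.descendants y + 1)) hu hv huv
      (fun _ _ hu' => by simp [BottleneckTree.nest, hu'])
  have hlog : Nat.log 2 (T.descendants v + T.descendants u + 1 + 1) ≤ Nat.log 2 N :=
    Nat.log_mono_right (by omega)
  simp only [potential]
  simp only [BottleneckTree.nest, Function.update_apply, if_true, if_neg huv] at hsum ⊢
  omega

end Nest

theorem raise (h : T.WellFormed N B) {c : ℕ} (hc : c ≤ B) : (T.raise u c).WellFormed N B := by
  refine ⟨h.parent_zero, h.parent_le, fun t ht => ?_, h.descendants_lt, h.descendants_eq⟩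
  rcases le_weight_raise_iff.1 (le_refl ((T.raise u c).weight t)) with hle | ⟨-, hle⟩
  exacts [hle.trans (h.weight_le t ht), hle.trans hc]

end WellFormed

theorem connected_nest (hu : u ∈ Finset.Icc 1 N) (hv : v ∈ Finset.Icc 1 N) (huv : u ≠ v)
    (hpu : T.parent u = 0) (hpv : T.parent v = 0) (hw : T.weight u ≤ T.weight v) (θ : ℕ) :
    (T.nest u v).connected N θ = T.connected N θ := by
  have parent_self : (T.nest u v).parent u = v := by simp [nest]
  have parent_of_ne {t : ℕ} (ht : t ≠ u) : (T.nest u v).parent t = T.parent t := by simp [nest, ht]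
  refine le_antisymm (connected_le_iff.2 fun t ht hθ => ?_) (connected_le_iff.2 fun t ht hθ => ?_)
  · change θ ≤ T.weight t at hθ
    rcases eq_or_ne t u with rfl | htu
    · rw [parent_self]
      exact Setoid.trans' _ (connected_of_parent_eq hu hpu hθ)
        (Setoid.symm' _ (connected_of_parent_eq hv hpv (hθ.trans hw)))
    · exact connected_of_parent_eq ht (parent_of_ne htu).symm hθ
  · rcases eq_or_ne t u with rfl | htu
    · rw [hpu, ← hpv]
      exact Setoid.trans' _ (connected_of_parent_eq hu parent_self hθ)
        (connected_of_parent_eq hv (parent_of_ne huv.symm) (hθ.trans hw))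
    · exact connected_of_parent_eq ht (parent_of_ne htu) hθ

/-- The tree is well-formed, and it has the same connections as the list `E` of edges. The threshold
`0` is excluded, since every vertex is connected to the root by edges of weight at least `0`. -/
structure Represents (N B : ℕ) (T : BottleneckTree) (E : List (WeightedEdge ℕ)) : Prop
    extends T.WellFormed N B where
  connected_eq : ∀ θ, 1 ≤ θ → T.connected N θ = WeightedEdge.connected E θ

theorem represents_zero (N B : ℕ) : Represents N B ⟨0, 0, 0⟩ [] where
  parent_zero := rfl
  parent_le _ _ := Nat.zero_le N
  weight_le _ _ := Nat.zero_le B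
  descendants_lt _ hx := (Finset.mem_Icc.1 hx).1.trans (Finset.mem_Icc.1 hx).2
  descendants_eq x hx := by
    simp [(Nat.one_le_iff_ne_zero.1 (Finset.mem_Icc.1 hx).1).symm]
  connected_eq θ hθ := by
    refine le_antisymm (WeightedEdge.connected_le_iff.2 fun e he hle => ?_) ?_
    · obtain ⟨x, -, rfl⟩ := List.mem_map.1 he
      exact absurd (hθ.trans hle) (by simp)
    · simp

namespace Represents

variable {E : List (WeightedEdge ℕ)} {e : WeightedEdge ℕ}

theorem of_connected_eq {T' : BottleneckTree} (h : T.Represents N B E)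
    (hT' : T'.WellFormed N B) (hconn : ∀ θ, T'.connected N θ = T.connected N θ) :
    T'.Represents N B E :=
  ⟨hT', fun θ hθ => (hconn θ).trans (h.connected_eq θ hθ)⟩

theorem le_weight_iff (h : T.Represents N B E) (hx : x ∈ Finset.Icc 1 N) (hθ : 1 ≤ θ) :
    θ ≤ T.weight x ↔ WeightedEdge.connected E θ x (T.parent x) := by
  rw [← h.connected_eq θ hθ, h.connected_parent_iff hx]

theorem min_weight_eq_superfluousWeight (h : T.Represents N B E) (hx : x ∈ Finset.Icc 1 N)
    (he : e.fst = x ∧ e.snd = T.parent x ∨ e.fst = T.parent x ∧ e.snd = x) :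
    min (T.weight x) e.weight = WeightedEdge.superfluousWeight E e := by
  refine WeightedEdge.eq_superfluousWeight fun θ hθ => ?_
  rw [le_min_iff, h.le_weight_iff hx hθ, and_comm]
  rcases he with ⟨hfst, hsnd⟩ | ⟨hfst, hsnd⟩ <;> rw [hfst, hsnd]
  rw [Setoid.comm']

theorem raise (h : T.Represents N B E) (hx : x ∈ Finset.Icc 1 N)
    (he : e.fst = x ∧ e.snd = T.parent x ∨ e.fst = T.parent x ∧ e.snd = x) (hB : e.weight ≤ B) :
    (T.raise x e.weight).Represents N B (e :: E) := by
  refine ⟨h.toWellFormed.raise hB, fun θ hθ => ?_⟩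
  have hedge {r : Setoid ℕ} : r e.fst e.snd ↔ r x (T.parent x) := by
    rcases he with ⟨hfst, hsnd⟩ | ⟨hfst, hsnd⟩ <;> rw [hfst, hsnd]
    rw [Setoid.comm']
  refine eq_of_forall_ge_iff fun r => ?_
  rw [WeightedEdge.connected_le_iff, List.forall_mem_cons, ← WeightedEdge.connected_le_iff,
    ← h.connected_eq θ hθ, connected_le_iff, connected_le_iff, hedge]
  refine ⟨fun hr => ⟨fun hle => hr x hx (le_weight_raise_iff.2 (.inr ⟨rfl, hle⟩)),
    fun t ht hle => hr t ht (le_weight_raise_iff.2 (.inl hle))⟩, fun ⟨hr, hr'⟩ t ht hle => ?_⟩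
  rcases le_weight_raise_iff.1 hle with hweight | ⟨rfl, hweight⟩
  exacts [hr' t ht hweight, hr hweight]

end Represents

end BottleneckTree

/-! ## A program logic for the random access machine -/

namespace RAM

/-- The value of an expression on the machine without bounds. -/
def Expr.val (σ : Memory) : Expr → ℕ
  | .lit c => c
  | .reg x => σ.reg x
  | .get a i => σ.arr a (i.val σ)
  | .add e₁ e₂ => e₁.val σ + e₂.val σ
  | .sub e₁ e₂ => e₁.val σ - e₂.val σ

/-- The evaluation of the expression stays within the bounds of the machine. -/
def Expr.Fits (W S : ℕ) (σ : Memory) : Expr → Prop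
  | .lit c => c < W
  | .reg x => σ.reg x < W
  | .get a i => i.Fits W S σ ∧ i.val σ < S ∧ σ.arr a (i.val σ) < W
  | .add e₁ e₂ => e₁.Fits W S σ ∧ e₂.Fits W S σ ∧ e₁.val σ + e₂.val σ < W
  | .sub e₁ e₂ => e₁.Fits W S σ ∧ e₂.Fits W S σ

theorem Expr.Fits.val_lt {W S : ℕ} {σ : Memory} {e : Expr} (h : e.Fits W S σ) : e.val σ < W := by
  induction e with
  | lit c => exact h
  | reg x => exact h
  | get a i _ => exact h.2.2
  | add e₁ e₂ _ _ => exact h.2.2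
  | sub e₁ e₂ ih₁ _ => exact (Nat.sub_le _ _).trans_lt (ih₁ h.1)

theorem Expr.Fits.eval_eq {W S : ℕ} {σ : Memory} {e : Expr} (h : e.Fits W S σ) :
    e.eval W S σ = some (e.val σ) := by
  induction e with
  | lit c => exact if_pos h
  | reg x => exact if_pos h
  | get a i ih =>
    simp only [Expr.eval, ih h.1, Option.bind_eq_bind, Option.bind_some, if_pos h.2.1]
    exact if_pos h.2.2
  | add e₁ e₂ ih₁ ih₂ =>
    simp only [Expr.eval, ih₁ h.1, ih₂ h.2.1, Option.bind_eq_bind, Option.bind_some]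
    exact if_pos h.2.2
  | sub e₁ e₂ ih₁ ih₂ =>
    simp only [Expr.eval, ih₁ h.1, ih₂ h.2, Option.bind_eq_bind, Option.bind_some]
    exact if_pos h.val_lt

/-- The truth of a test on the machine without bounds. -/
def Cond.Holds (σ : Memory) : Cond → Prop
  | .eq e₁ e₂ => e₁.val σ = e₂.val σ
  | .lt e₁ e₂ => e₁.val σ < e₂.val σ
  | .not b => ¬ b.Holds σ
  | .and b₁ b₂ => b₁.Holds σ ∧ b₂.Holds σ

/-- The evaluation of the test stays within the bounds of the machine. -/
def Cond.Fits (W S : ℕ) (σ : Memory) : Cond → Prop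
  | .eq e₁ e₂ => e₁.Fits W S σ ∧ e₂.Fits W S σ
  | .lt e₁ e₂ => e₁.Fits W S σ ∧ e₂.Fits W S σ
  | .not b => b.Fits W S σ
  | .and b₁ b₂ => b₁.Fits W S σ ∧ b₂.Fits W S σ

theorem Cond.Fits.exists_eval_eq {W S : ℕ} {σ : Memory} {b : Cond} (h : b.Fits W S σ) :
    ∃ c, b.eval W S σ = some c ∧ (c = true ↔ b.Holds σ) := by
  induction b with
  | eq e₁ e₂ =>
    exact ⟨_, by simp only [Cond.eval, h.1.eval_eq, h.2.eval_eq]; rfl, by simp [Cond.Holds]⟩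
  | lt e₁ e₂ =>
    exact ⟨_, by simp only [Cond.eval, h.1.eval_eq, h.2.eval_eq]; rfl, by simp [Cond.Holds]⟩
  | not b ih =>
    obtain ⟨c, hc, h'⟩ := ih h
    exact ⟨!c, by simp [Cond.eval, hc], by simp [Cond.Holds, ← h']⟩
  | and b₁ b₂ ih₁ ih₂ =>
    obtain ⟨c₁, hc₁, h₁⟩ := ih₁ h.1
    obtain ⟨c₂, hc₂, h₂⟩ := ih₂ h.2
    exact ⟨c₁ && c₂, by simp [Cond.eval, hc₁, hc₂], by simp [Cond.Holds, ← h₁, ← h₂]⟩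

theorem Cond.Fits.eval_eq_true {W S : ℕ} {σ : Memory} {b : Cond} (h : b.Fits W S σ)
    (hb : b.Holds σ) : b.eval W S σ = some true := by
  obtain ⟨c, hc, h'⟩ := h.exists_eval_eq
  rw [hc, h'.2 hb]

theorem Cond.Fits.eval_eq_false {W S : ℕ} {σ : Memory} {b : Cond} (h : b.Fits W S σ)
    (hb : ¬ b.Holds σ) : b.eval W S σ = some false := by
  obtain ⟨c, hc, h'⟩ := h.exists_eval_eq
  rw [hc, Bool.eq_false_iff.2 (mt h'.1 hb)]

/-- The program halts, and its step count and final memory satisfy `Q`. -/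
def Ensures (W S : ℕ) (p : Program) (σ : Memory) (Q : ℕ → Memory → Prop) : Prop :=
  ∃ t τ, Run W S p σ t τ ∧ Q t τ

section
variable {W S : ℕ} {σ : Memory} {p q : Program} {b : Cond} {Q Q' : ℕ → Memory → Prop}

theorem Ensures.mono (h : Ensures W S p σ Q') (hQ : ∀ t τ, Q' t τ → Q t τ) :
    Ensures W S p σ Q :=
  let ⟨t, τ, hr, hq⟩ := h
  ⟨t, τ, hr, hQ t τ hq⟩

theorem ensures_assign {x : ℕ} {e : Expr} (he : e.Fits W S σ)
    (hQ : Q (e.cost + 1) (σ.setReg x (e.val σ))) : Ensures W S (.assign x e) σ Q :=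
  ⟨_, _, .assign he.eval_eq, hQ⟩

theorem ensures_store {a : ℕ} {i e : Expr} (hi : i.Fits W S σ) (hk : i.val σ < S)
    (he : e.Fits W S σ) (hQ : Q (i.cost + e.cost + 1) (σ.setArr a (i.val σ) (e.val σ))) :
    Ensures W S (.store a i e) σ Q :=
  ⟨_, _, .store hi.eval_eq hk he.eval_eq, hQ⟩

theorem ensures_seq (h : Ensures W S p σ fun t τ => Ensures W S q τ fun t' => Q (t + t')) :
    Ensures W S (.seq p q) σ Q :=
  let ⟨_, _, hr, _, _, hr', hq⟩ := h
  ⟨_, _, .seq hr hr', hq⟩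

theorem ensures_skip (hQ : Q 1 σ) : Ensures W S .skip σ Q := ⟨_, _, .skip σ, hQ⟩

theorem ensures_ite (hb : b.Fits W S σ)
    (hp : b.Holds σ → Ensures W S p σ fun t => Q (b.cost + 1 + t))
    (hq : ¬ b.Holds σ → Ensures W S q σ fun t => Q (b.cost + 1 + t)) :
    Ensures W S (.ite b p q) σ Q := by
  by_cases h : b.Holds σ
  · obtain ⟨t, τ, hr, hQ⟩ := hp h
    exact ⟨_, _, .ite_true (hb.eval_eq_true h) hr, hQ⟩
  · obtain ⟨t, τ, hr, hQ⟩ := hq h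
    exact ⟨_, _, .ite_false (hb.eval_eq_false h) hr, hQ⟩

theorem ensures_while_of_not (hb : b.Fits W S σ) (h : ¬ b.Holds σ) (hQ : Q (b.cost + 1) σ) :
    Ensures W S (.while b p) σ Q := ⟨_, _, .while_false (hb.eval_eq_false h), hQ⟩

/-- The credit `μ` pays for every round of the loop. -/
theorem ensures_while (I : Memory → Prop) (μ : Memory → ℕ)
    (hb : ∀ σ, I σ → b.Fits W S σ)
    (hp : ∀ σ, I σ → b.Holds σ →
      Ensures W S p σ fun t τ => I τ ∧ t + (b.cost + 1) + μ τ ≤ μ σ)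
    (hσ : I σ) :
    Ensures W S (.while b p) σ
      fun t τ => I τ ∧ ¬ b.Holds τ ∧ t + μ τ ≤ μ σ + (b.cost + 1) := by
  induction hk : μ σ using Nat.strong_induction_on generalizing σ with
  | _ k ih =>
    subst hk
    by_cases h : b.Holds σ
    · obtain ⟨t, τ, hr, hI, ht⟩ := hp σ hσ h
      obtain ⟨t', τ', hr', hI', hb', ht'⟩ := ih (μ τ) (by omega) hI rfl
      exact ⟨_, _, .while_true ((hb σ hσ).eval_eq_true h) hr hr', hI', hb', by omega⟩
    · exact ⟨_, _, .while_false ((hb σ hσ).eval_eq_false h), hσ, h, by omega⟩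

end

end RAM

/-! ## Programs for bottleneck trees -/

namespace RAM

open BottleneckTree

attribute [local simp] Expr.Fits Expr.val Expr.cost Cond.Fits Cond.Holds Cond.cost Memory.setReg
  Memory.setArr Function.update_apply

/-- The tree whose parents, weights and numbers of descendants are in the arrays `a`, `a + 1` and
`a + 2`. -/
def treeAt (a : ℕ) (σ : Memory) : BottleneckTree := ⟨σ.arr a, σ.arr (a + 1), σ.arr (a + 2)⟩

/-- At most the registers from `lo` on and the arrays of the tree at `a` are changed. -/
structure Frame (a lo : ℕ) (σ τ : Memory) : Prop where
  reg_eq : ∀ r < lo, τ.reg r = σ.reg r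
  arr_eq : ∀ b, b < a ∨ a + 2 < b → τ.arr b = σ.arr b

theorem Frame.refl (a lo : ℕ) (σ : Memory) : Frame a lo σ σ := ⟨fun _ _ => rfl, fun _ _ => rfl⟩

theorem Frame.trans {a lo : ℕ} {σ τ υ : Memory} (h : Frame a lo σ τ) (h' : Frame a lo τ υ) :
    Frame a lo σ υ :=
  ⟨fun r hr => (h'.reg_eq r hr).trans (h.reg_eq r hr),
    fun b hb => (h'.arr_eq b hb).trans (h.arr_eq b hb)⟩

theorem Frame.mono {a lo lo' : ℕ} {σ τ : Memory} (h : Frame a lo σ τ) (hlo : lo' ≤ lo) :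
    Frame a lo' σ τ :=
  ⟨fun r hr => h.reg_eq r (hr.trans_le hlo), h.arr_eq⟩

theorem Frame.setReg {a lo : ℕ} (σ : Memory) {x : ℕ} (v : ℕ) (h : lo ≤ x) :
    Frame a lo σ (σ.setReg x v) :=
  ⟨fun r hr => by simp [show r ≠ x by omega], fun _ _ => rfl⟩

theorem treeAt_setReg (a : ℕ) (σ : Memory) (x v : ℕ) : treeAt a (σ.setReg x v) = treeAt a σ := rfl

/-- Promote the vertex in register `10`. -/
def promoteProgram (a : ℕ) : Program :=
  .seq (.assign 11 (.get a (.reg 10))) <|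
  .seq (.assign 12 (.get a (.reg 11))) <|
  .ite (.lt (.get (a + 1) (.reg 11)) (.get (a + 1) (.reg 10)))
    (.seq (.assign 13 (.get (a + 1) (.reg 10))) <|
     .seq (.store (a + 1) (.reg 10) (.get (a + 1) (.reg 11))) <|
     .seq (.store (a + 1) (.reg 11) (.reg 13)) <|
     .seq (.assign 13 (.get (a + 2) (.reg 11))) <|
     .seq (.store (a + 2) (.reg 11) (.sub (.reg 13) (.add (.get (a + 2) (.reg 10)) (.lit 1)))) <|
     .seq (.store (a + 2) (.reg 10) (.reg 13)) <|
     .seq (.store a (.reg 11) (.reg 10)) (.store a (.reg 10) (.reg 12)))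
    (.seq (.store (a + 2) (.reg 11)
        (.sub (.get (a + 2) (.reg 11)) (.add (.get (a + 2) (.reg 10)) (.lit 1))))
      (.store a (.reg 10) (.reg 12)))

/-- Put the vertex to be promoted in order to bring the vertex in register `9` to the top into
register `10`. -/
def selectProgram (a : ℕ) : Program :=
  .seq (.assign 10 (.reg 9)) <|
  .seq (.assign 11 (.get a (.reg 9))) <|
  .seq (.assign 12 (.get a (.reg 11))) <|
  .ite (.eq (.reg 12) (.lit 0)) .skip <|
  .ite (.eq (.get a (.reg 12)) (.lit 0)) .skip <|
  .ite (.lt (.add (.get (a + 2) (.reg 12)) (.get (a + 2) (.reg 12)))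
      (.add (.get (a + 2) (.reg 11)) (.add (.get (a + 2) (.reg 11))
        (.add (.get (a + 2) (.reg 11)) (.lit 2)))))
    (.assign 10 (.reg 11)) .skip

/-- Bring the vertex in register `r` to the top. -/
def perchProgram (a r : ℕ) : Program :=
  .seq (.assign 9 (.reg r)) <|
  .while (.not (.eq (.get a (.reg 9)) (.lit 0))) (.seq (selectProgram a) (promoteProgram a))

/-- Make the vertex in register `7` a child of the vertex in register `8`. -/
def nestProgram (a : ℕ) : Program :=
  .seq (.store a (.reg 7) (.reg 8))
    (.store (a + 2) (.reg 8)
      (.add (.add (.get (a + 2) (.reg 8)) (.get (a + 2) (.reg 7))) (.lit 1)))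

/-- Make that one of the vertices in the registers `7` and `8` which is below the lighter edge a
child of the other one, and put the child into register `7`. -/
def nestLighterProgram (a : ℕ) : Program :=
  .seq
    (.ite (.lt (.get (a + 1) (.reg 8)) (.get (a + 1) (.reg 7)))
      (.seq (.assign 7 (.reg 4)) (.assign 8 (.reg 3))) .skip)
    (nestProgram a)

/-- Make one of the vertices in the registers `3` and `4` a child of the other one, and put the
child into register `7`. -/
def joinProgram (a : ℕ) : Program :=
  .seq (.seq (perchProgram a 3) (perchProgram a 4)) <|
  .seq (.assign 7 (.reg 3)) <| .seq (.assign 8 (.reg 4)) <|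
  .ite (.eq (.get a (.reg 7)) (.reg 8)) .skip (nestLighterProgram a)

/-- Raise the weight above the vertex in register `7` to at least the number in register `5`, and
put the smaller one of both weights into register `6`. -/
def raiseProgram (a : ℕ) : Program :=
  .ite (.lt (.get (a + 1) (.reg 7)) (.reg 5))
    (.seq (.assign 6 (.get (a + 1) (.reg 7))) (.store (a + 1) (.reg 7) (.reg 5)))
    (.assign 6 (.reg 5))

/-- Insert an edge between the vertices in the registers `3` and `4`, of the weight in register
`5`. The weight of the superfluous edge is put into register `6`. -/
def insertProgram (a : ℕ) : Program :=
  .ite (.eq (.reg 3) (.reg 4)) (.assign 6 (.reg 5)) (.seq (joinProgram a) (raiseProgram a))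

theorem ensures_raiseProgram {W S a : ℕ} {σ : Memory} (hu : σ.reg 7 < S) (huW : σ.reg 7 < W)
    (hweight : (treeAt a σ).weight (σ.reg 7) < W) (h5 : σ.reg 5 < W) :
    Ensures W S (raiseProgram a) σ fun t τ =>
      t ≤ 20 ∧ treeAt a τ = (treeAt a σ).raise (σ.reg 7) (σ.reg 5) ∧
        τ.reg 6 = min ((treeAt a σ).weight (σ.reg 7)) (σ.reg 5) ∧ Frame a 6 σ τ := by
  simp only [treeAt] at hweight ⊢
  refine ensures_ite (by simp [*]) (fun hc => ?_) (fun hc => ?_) <;>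
    simp only [Cond.Holds, Expr.val] at hc
  · refine ensures_seq (ensures_assign (by simp [*])
      (ensures_store (by simp [*]) (by simpa using hu) (by simp [*]) ?_))
    refine ⟨by simp, ?_, by simpa using hc.le, fun r hr => ?_, fun b hb => ?_⟩
    · simp [BottleneckTree.raise, max_eq_right hc.le]
    · simp [show r ≠ 6 by omega]
    · simp [show b ≠ a + 1 by omega]
  · refine ensures_assign (by simp [*]) ⟨by simp, ?_, ?_, Frame.setReg _ _ le_rfl⟩
    · simp [BottleneckTree.raise, max_eq_left (not_lt.1 hc)]
    · simpa using not_lt.1 hc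

section Specifications

variable {W S N B a : ℕ} {σ : Memory} {E : List (WeightedEdge ℕ)} (hW : 4 * N + B + 10 < W)
  (hS : N < S)
include hW hS

theorem ensures_promoteProgram (hT : (treeAt a σ).WellFormed N B)
    (hx : σ.reg 10 ∈ Finset.Icc 1 N) (hp : (treeAt a σ).parent (σ.reg 10) ≠ 0) :
    Ensures W S (promoteProgram a) σ fun t τ =>
      t ≤ 100 ∧ treeAt a τ = (treeAt a σ).promote (σ.reg 10) ∧ Frame a 10 σ τ := by
  have hy := hT.parent_mem hx hp
  have hyx := hT.parent_ne hx
  have hz_le := hT.parent_le _ hy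
  have hwy_le := hT.weight_le _ hy
  have hwx_le := hT.weight_le _ hx
  have hsy_lt := hT.descendants_lt _ hy
  have hsx_lt := hT.descendants_lt _ hx
  rw [Finset.mem_Icc] at hx hy
  simp only [treeAt] at *
  generalize hreg : σ.reg 10 = x at *
  generalize harr : σ.arr a x = y at *
  unfold promoteProgram
  repeat' first
    | apply ensures_seq
    | refine ensures_assign ?_ ?_
    | refine ensures_store ?_ ?_ ?_ ?_
    | refine ensures_ite ?_ (fun hc => ?_) (fun hc => ?_)
  all_goals try simp [hreg, harr] at hc
  all_goals simp [hreg, harr]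
  all_goals try omega
  · refine ⟨by simp [promote, rotate, harr, hc], ?_, ?_⟩ <;> intro r hr <;>
      simp only [Function.update_apply] <;> split_ifs <;> first | omega | rfl
  · refine ⟨by simp [promote, shortcut, harr, hc], ?_, ?_⟩ <;> intro r hr <;>
      simp only [Function.update_apply] <;> split_ifs <;> first | omega | rfl

theorem ensures_selectProgram (hT : (treeAt a σ).WellFormed N B) (hu : σ.reg 9 ∈ Finset.Icc 1 N)
    (hp : (treeAt a σ).parent (σ.reg 9) ≠ 0) :
    Ensures W S (selectProgram a) σ fun t τ =>
      t ≤ 60 ∧ τ.reg 10 = (treeAt a σ).nextPromoted (σ.reg 9) ∧ τ.arr = σ.arr ∧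
        Frame a 10 σ τ := by
  obtain ⟨u, hreg⟩ : ∃ u, σ.reg 9 = u := ⟨_, rfl⟩
  rw [hreg] at hu hp ⊢
  obtain ⟨y, hy_eq⟩ : ∃ y, σ.arr a u = y := ⟨_, rfl⟩
  obtain ⟨z, hz_eq⟩ : ∃ z, σ.arr a y = z := ⟨_, rfl⟩
  have hy : y ∈ Finset.Icc 1 N := hy_eq ▸ hT.parent_mem hu hp
  have hz : z ≤ N := hz_eq ▸ hT.parent_le _ hy
  have hsy_lt : σ.arr (a + 2) y < N := hT.descendants_lt _ hy
  have hz_lt : z ≠ 0 → σ.arr a z ≤ N ∧ σ.arr (a + 2) z < N := fun h =>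
    ⟨hT.parent_le z (by simp; omega), hT.descendants_lt z (by simp; omega)⟩
  rw [Finset.mem_Icc] at hu hy
  have hnext : (treeAt a σ).nextPromoted u = if z ≠ 0 ∧ σ.arr a z ≠ 0 ∧
      2 * (σ.arr (a + 2) z + 1) ≤ 3 * (σ.arr (a + 2) y + 1) then y else u := by
    subst hz_eq hy_eq
    rfl
  rw [hnext]
  have frame_of {f : ℕ → ℕ} (hf : ∀ r < 10, f r = σ.reg r) : Frame a 10 σ ⟨f, σ.arr⟩ :=
    ⟨hf, fun _ _ => rfl⟩
  unfold selectProgram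
  repeat' first
    | apply ensures_seq
    | refine ensures_assign ?_ ?_
    | refine ensures_skip ?_
    | refine ensures_ite ?_ (fun hc => ?_) (fun hc => ?_)
  all_goals try simp [hreg, hy_eq, hz_eq] at *
  all_goals try omega
  all_goals
    refine ⟨by omega, frame_of fun r hr => ?_⟩
    simp only [Function.update_apply]
    split_ifs <;> omega

theorem ensures_select_promote (hT : (treeAt a σ).WellFormed N B) (hu : σ.reg 9 ∈ Finset.Icc 1 N)
    (hp : (treeAt a σ).parent (σ.reg 9) ≠ 0) :
    Ensures W S (.seq (selectProgram a) (promoteProgram a)) σ fun t τ =>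
      t ≤ 160 ∧ treeAt a τ = (treeAt a σ).promote ((treeAt a σ).nextPromoted (σ.reg 9)) ∧
        Frame a 10 σ τ := by
  have hnext := hT.nextPromoted_mem hu hp
  refine ensures_seq ((ensures_selectProgram hW hS hT hu hp).mono ?_)
  rintro t τ ⟨ht, hreg, harr, hframe⟩
  have htree : treeAt a τ = treeAt a σ := by simp [treeAt, harr]
  refine (ensures_promoteProgram hW hS (htree ▸ hT) (hreg ▸ hnext.1)
    (by rw [htree, hreg]; exact hnext.2)).mono ?_
  rintro t' τ' ⟨ht', htree', hframe'⟩
  exact ⟨by omega, by rw [htree', htree, hreg], hframe.trans hframe'⟩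

theorem ensures_perch_loop (hT : (treeAt a σ).Represents N B E) (hu : σ.reg 9 ∈ Finset.Icc 1 N) :
    Ensures W S
      (.while (.not (.eq (.get a (.reg 9)) (.lit 0))) (.seq (selectProgram a) (promoteProgram a))) σ
      fun t τ => t + 200 * (treeAt a τ).potential N ≤
          200 * (treeAt a σ).potential N + 600 * (Nat.log 2 N + 1) + 10 ∧
        (treeAt a τ).Represents N B E ∧ (treeAt a τ).parent (σ.reg 9) = 0 ∧
        (∀ o, (treeAt a σ).parent o = 0 →
          (treeAt a τ).parent o = 0 ∨ (treeAt a τ).parent o = σ.reg 9) ∧ Frame a 10 σ τ := by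
  obtain ⟨u, hreg⟩ : ∃ u, σ.reg 9 = u := ⟨_, rfl⟩
  rw [hreg] at hu ⊢
  refine (ensures_while
    (fun τ => (treeAt a τ).Represents N B E ∧ Frame a 10 σ τ ∧
      ∀ o, (treeAt a σ).parent o = 0 → (treeAt a τ).parent o = 0 ∨
        (treeAt a τ).parent o = u ∧ (treeAt a τ).parent u = 0)
    (fun τ => 200 * (treeAt a τ).credit N u) ?_ ?_ ⟨hT, .refl _ _ _, fun o ho => .inl ho⟩).mono ?_
  · rintro τ ⟨hτ, hframe, -⟩
    have hreg_τ : τ.reg 9 = u := (hframe.reg_eq 9 (by omega)).trans hreg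
    have hle : τ.arr a u ≤ N := hτ.parent_le u hu
    rw [Finset.mem_Icc] at hu
    simp [hreg_τ]
    omega
  · rintro τ ⟨hτ, hframe, hother⟩ hb
    have hreg_τ : τ.reg 9 = u := (hframe.reg_eq 9 (by omega)).trans hreg
    have hp : (treeAt a τ).parent u ≠ 0 := by simpa [hreg_τ, treeAt] using hb
    have hnext := hτ.nextPromoted_mem hu hp
    have hcredit := hτ.credit_promote_nextPromoted_lt hu hp
    refine (ensures_select_promote hW hS hτ.toWellFormed (hreg_τ ▸ hu) (hreg_τ ▸ hp)).mono ?_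
    rintro t τ' ⟨ht, htree, hframe'⟩
    rw [hreg_τ] at htree
    rw [htree]
    refine ⟨⟨hτ.of_connected_eq (hτ.promote hnext.1 hnext.2)
      (hτ.connected_promote hnext.1 hnext.2), hframe.trans hframe', fun o ho => ?_⟩, ?_⟩
    · exact parent_promote_nextPromoted_eq_zero_or _ hp
        ((hother o ho).resolve_right fun h => hp h.2)
    · simp only [Cond.cost, Expr.cost]
      omega
  · rintro t τ ⟨⟨hτ, hframe, hother⟩, hb, ht⟩
    have hreg_τ : τ.reg 9 = u := (hframe.reg_eq 9 (by omega)).trans hreg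
    have hcredit := credit_le (N := N) (treeAt a σ) u
    have hpotential := hτ.potential_le_credit hu
    simp only [Cond.cost, Expr.cost] at ht
    exact ⟨by omega, hτ, by simpa [hreg_τ, treeAt] using hb,
      fun o ho => (hother o ho).imp_right And.left, hframe⟩

theorem ensures_perchProgram {r : ℕ} (hT : (treeAt a σ).Represents N B E)
    (hu : σ.reg r ≤ N) :
    Ensures W S (perchProgram a r) σ fun t τ =>
      t + 200 * (treeAt a τ).potential N ≤
          200 * (treeAt a σ).potential N + 600 * (Nat.log 2 N + 1) + 20 ∧
        (treeAt a τ).Represents N B E ∧ (treeAt a τ).parent (σ.reg r) = 0 ∧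
        (∀ o, (treeAt a σ).parent o = 0 →
          (treeAt a τ).parent o = 0 ∨ (treeAt a τ).parent o = σ.reg r) ∧ Frame a 9 σ τ := by
  have hreg : (σ.setReg 9 (σ.reg r)).reg 9 = σ.reg r := by simp
  have hframe := Frame.setReg (a := a) σ (σ.reg r) (le_refl 9)
  refine ensures_seq (ensures_assign (by simp; omega) ?_)
  rcases Nat.eq_zero_or_pos (σ.reg r) with hu0 | hu0
  · have hparent := hT.parent_zero
    simp only [treeAt] at hparent
    refine ensures_while_of_not (by simp [hu0, hparent]; omega) (by simp [hu0, hparent]) ?_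
    refine ⟨?_, hT, by rw [hu0]; exact hparent, fun o ho => .inl ho, hframe⟩
    simp only [Cond.cost, Expr.cost, Expr.val, treeAt_setReg]
    omega
  · refine (ensures_perch_loop hW hS (σ := σ.setReg 9 (σ.reg r)) hT
      (by rw [hreg, Finset.mem_Icc]; omega)).mono ?_
    rintro t τ ⟨ht, hτ, hparent, hother, hframe'⟩
    rw [hreg] at hparent hother
    rw [treeAt_setReg] at ht
    refine ⟨?_, hτ, hparent, hother, hframe.trans (hframe'.mono (by omega))⟩
    simp only [Expr.cost]
    omega

theorem ensures_nestProgram {u v : ℕ} (hT : (treeAt a σ).Represents N B E)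
    (h7 : σ.reg 7 = u) (h8 : σ.reg 8 = v) (hu : u ∈ Finset.Icc 1 N) (hv : v ∈ Finset.Icc 1 N)
    (huv : u ≠ v) (hpu : (treeAt a σ).parent u = 0) (hpv : (treeAt a σ).parent v = 0)
    (hw : (treeAt a σ).weight u ≤ (treeAt a σ).weight v) :
    Ensures W S (nestProgram a) σ fun t τ =>
      t + 200 * (treeAt a τ).potential N ≤
          200 * (treeAt a σ).potential N + 200 * Nat.log 2 N + 20 ∧
        (treeAt a τ).Represents N B E ∧ (treeAt a τ).parent u = v ∧ Frame a 9 σ τ := by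
  have hdesc := hT.descendants_add_descendants_le hu hv huv hpu hpv
  have hpotential := hT.potential_nest_le hu hv huv hpu hpv
  have hnest : (treeAt a σ).nest u v = treeAt a ((σ.setArr a u v).setArr (a + 2) v
      (σ.arr (a + 2) v + σ.arr (a + 2) u + 1)) := by
    simp [treeAt, nest]
  have hrep := hT.of_connected_eq (hT.nest hu hv huv hpu hpv)
    (connected_nest hu hv huv hpu hpv hw)
  rw [hnest] at hpotential hrep
  rw [Finset.mem_Icc] at hu hv
  simp only [treeAt] at hdesc
  refine ensures_seq (ensures_store (by simp; omega) (by simp; omega) (by simp; omega) ?_)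
  refine ensures_store (by simp [h8]; omega) (by simp [h8]; omega)
    (by simp [h7, h8]; omega) ?_
  simp only [Expr.val, Expr.cost] at hpotential hrep ⊢
  refine ⟨?_, ?_, ?_, fun _ _ => rfl, fun b hb => ?_⟩
  · simp [h7, h8] at hpotential ⊢
    omega
  · simpa [h7, h8] using hrep
  · simp [treeAt, h7, h8]
  · simp [show b ≠ a by omega, show b ≠ a + 2 by omega]

theorem ensures_nestLighterProgram (hT : (treeAt a σ).Represents N B E) (h7 : σ.reg 7 = σ.reg 3)
    (h8 : σ.reg 8 = σ.reg 4) (hu : σ.reg 3 ∈ Finset.Icc 1 N) (hv : σ.reg 4 ∈ Finset.Icc 1 N)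
    (huv : σ.reg 3 ≠ σ.reg 4) (hpu : (treeAt a σ).parent (σ.reg 3) = 0)
    (hpv : (treeAt a σ).parent (σ.reg 4) = 0) :
    Ensures W S (nestLighterProgram a) σ fun t τ =>
      t + 200 * (treeAt a τ).potential N ≤
          200 * (treeAt a σ).potential N + 200 * Nat.log 2 N + 40 ∧
        (treeAt a τ).Represents N B E ∧ τ.reg 7 ∈ Finset.Icc 1 N ∧
        (σ.reg 3 = τ.reg 7 ∧ σ.reg 4 = (treeAt a τ).parent (τ.reg 7) ∨
          σ.reg 3 = (treeAt a τ).parent (τ.reg 7) ∧ σ.reg 4 = τ.reg 7) ∧ Frame a 7 σ τ := by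
  have hwu := hT.weight_le _ hu
  have hwv := hT.weight_le _ hv
  have huN := Finset.mem_Icc.1 hu
  have hvN := Finset.mem_Icc.1 hv
  simp only [treeAt] at hwu hwv
  refine ensures_seq (ensures_ite (by simp [h7, h8]; omega) (fun hc => ?_) (fun hc => ?_)) <;>
    simp only [Cond.Holds, Expr.val, h7, h8] at hc
  · refine ensures_seq (ensures_assign (by simp; omega) (ensures_assign (by simp; omega) ?_))
    refine (ensures_nestProgram hW hS (σ := (σ.setReg 7 (σ.reg 4)).setReg 8 (σ.reg 3)) hT
      (by simp) (by simp) hv hu huv.symm hpv hpu hc.le).mono ?_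
    rintro t τ ⟨ht, hτ, hparent, hframe⟩
    have h7' : τ.reg 7 = σ.reg 4 := by simpa using hframe.reg_eq 7 (by omega)
    simp only [treeAt_setReg] at ht
    rw [h7', hparent]
    refine ⟨?_, hτ, hv, .inr ⟨rfl, rfl⟩, .trans ?_ (hframe.mono (by omega))⟩
    · simp
      omega
    · exact (Frame.setReg _ _ le_rfl).trans (Frame.setReg _ _ (by omega))
  · refine ensures_skip ((ensures_nestProgram hW hS hT h7 h8 hu hv huv hpu hpv
      (not_lt.1 hc)).mono ?_)
    rintro t τ ⟨ht, hτ, hparent, hframe⟩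
    rw [hframe.reg_eq 7 (by omega), h7, hparent]
    refine ⟨?_, hτ, hu, .inl ⟨rfl, rfl⟩, hframe.mono (by omega)⟩
    simp
    omega

theorem ensures_perch_perch (hT : (treeAt a σ).Represents N B E) (hu : σ.reg 3 ≤ N)
    (hv : σ.reg 4 ≤ N) :
    Ensures W S (.seq (perchProgram a 3) (perchProgram a 4)) σ fun t τ =>
      t + 200 * (treeAt a τ).potential N ≤
          200 * (treeAt a σ).potential N + 1200 * (Nat.log 2 N + 1) + 40 ∧
        (treeAt a τ).Represents N B E ∧ (treeAt a τ).parent (σ.reg 4) = 0 ∧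
        ((treeAt a τ).parent (σ.reg 3) = 0 ∨ (treeAt a τ).parent (σ.reg 3) = σ.reg 4) ∧
        Frame a 9 σ τ := by
  refine ensures_seq ((ensures_perchProgram hW hS hT hu).mono ?_)
  rintro t τ ⟨ht, hτ, hpu, -, hframe⟩
  have h4 : τ.reg 4 = σ.reg 4 := hframe.reg_eq 4 (by omega)
  refine (ensures_perchProgram hW hS hτ (h4 ▸ hv)).mono ?_
  rintro t' τ' ⟨ht', hτ', hpv, hother, hframe'⟩
  rw [h4] at hpv hother
  exact ⟨by omega, hτ', hpv, hother _ hpu, hframe.trans hframe'⟩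

theorem ensures_joinProgram (hT : (treeAt a σ).Represents N B E) (hu : σ.reg 3 ∈ Finset.Icc 1 N)
    (hv : σ.reg 4 ≤ N) (huv : σ.reg 3 ≠ σ.reg 4) :
    Ensures W S (joinProgram a) σ fun t τ =>
      t + 200 * (treeAt a τ).potential N ≤
          200 * (treeAt a σ).potential N + 1400 * (Nat.log 2 N + 1) + 100 ∧
        (treeAt a τ).Represents N B E ∧ τ.reg 7 ∈ Finset.Icc 1 N ∧
        (σ.reg 3 = τ.reg 7 ∧ σ.reg 4 = (treeAt a τ).parent (τ.reg 7) ∨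
          σ.reg 3 = (treeAt a τ).parent (τ.reg 7) ∧ σ.reg 4 = τ.reg 7) ∧ Frame a 7 σ τ := by
  have huN := Finset.mem_Icc.1 hu
  refine ensures_seq ((ensures_perch_perch hW hS hT huN.2 hv).mono ?_)
  rintro t τ ⟨ht, hτ, hpv, hpu, hframe⟩
  have h3 : τ.reg 3 = σ.reg 3 := hframe.reg_eq 3 (by omega)
  have h4 : τ.reg 4 = σ.reg 4 := hframe.reg_eq 4 (by omega)
  rw [← h3] at hu huN huv hpu ⊢
  rw [← h4] at hv huv hpv hpu ⊢
  have hframe_set := (hframe.mono (show 7 ≤ 9 by omega)).trans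
    ((Frame.setReg τ (τ.reg 3) le_rfl).trans (Frame.setReg _ (τ.reg 4) (show 7 ≤ 8 by omega)))
  refine ensures_seq (ensures_assign (by simp; omega) (ensures_seq
    (ensures_assign (by simp; omega) (ensures_ite ?_ (fun hc => ?_) (fun hc => ?_)))))
  · have hle : τ.arr a (τ.reg 3) ≤ N := hτ.parent_le _ hu
    simp
    omega
  · have hc' : (treeAt a τ).parent (τ.reg 3) = τ.reg 4 := by simpa [treeAt] using hc
    refine ensures_skip ⟨?_, hτ, by simpa using hu, .inl ⟨by simp, ?_⟩, hframe_set⟩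
    · simp [treeAt] at ht ⊢
      omega
    · simpa [treeAt] using hc'.symm
  · have hc' : (treeAt a τ).parent (τ.reg 3) ≠ τ.reg 4 := by simpa [treeAt] using hc
    have hpu' := hpu.resolve_right hc'
    have hv0 : τ.reg 4 ≠ 0 := fun h => hc' (by rw [hpu', h])
    refine (ensures_nestLighterProgram hW hS
      (σ := (τ.setReg 7 (τ.reg 3)).setReg 8 (τ.reg 4)) hτ (by simp) (by simp) hu
      (Finset.mem_Icc.2 ⟨by simp; omega, by simpa using hv⟩) huv hpu' hpv).mono ?_
    rintro t' τ' ⟨ht', hτ', hmem, hpair, hframe'⟩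
    refine ⟨?_, hτ', hmem, hpair, hframe_set.trans hframe'⟩
    simp only [treeAt_setReg] at ht'
    simp
    omega

theorem ensures_insertProgram (hT : (treeAt a σ).Represents N B E)
    (hu : σ.reg 3 ∈ Finset.Icc 1 N) (hv : σ.reg 4 ≤ N) (hc : σ.reg 5 ≤ B) :
    Ensures W S (insertProgram a) σ fun t τ =>
      t + 200 * (treeAt a τ).potential N ≤
          200 * (treeAt a σ).potential N + 2000 * (Nat.log 2 N + 1) ∧
        (treeAt a τ).Represents N B (⟨σ.reg 3, σ.reg 4, σ.reg 5⟩ :: E) ∧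
        τ.reg 6 = WeightedEdge.superfluousWeight E ⟨σ.reg 3, σ.reg 4, σ.reg 5⟩ ∧
        Frame a 6 σ τ := by
  have huN := Finset.mem_Icc.1 hu
  refine ensures_ite (by simp; omega) (fun huv => ?_) (fun huv => ?_) <;>
    simp only [Cond.Holds, Expr.val] at huv
  · refine ensures_assign (by simp; omega) ⟨?_, ⟨hT.toWellFormed, fun θ hθ => ?_⟩, ?_,
      Frame.setReg _ _ le_rfl⟩
    · simp only [treeAt_setReg, Cond.cost, Expr.cost]
      omega
    · rw [WeightedEdge.connected_cons_of_fst_eq_snd huv]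
      exact hT.connected_eq θ hθ
    · rw [WeightedEdge.superfluousWeight_of_fst_eq_snd huv]
      simp
  · refine ensures_seq ((ensures_joinProgram hW hS hT hu hv huv).mono ?_)
    rintro t τ ⟨ht, hτ, hx, hpair, hframe⟩
    have h5 : τ.reg 5 = σ.reg 5 := hframe.reg_eq 5 (by omega)
    have hxN := Finset.mem_Icc.1 hx
    have hweight := hτ.weight_le _ hx
    refine (ensures_raiseProgram (by omega) (by omega) (by omega) (by omega)).mono ?_
    rintro t' τ' ⟨ht', htree, hreg, hframe'⟩
    rw [htree, hreg, h5]
    refine ⟨?_, hτ.raise (e := ⟨σ.reg 3, σ.reg 4, σ.reg 5⟩) hx hpair hc,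
      hτ.min_weight_eq_superfluousWeight (e := ⟨σ.reg 3, σ.reg 4, σ.reg 5⟩) hx hpair,
      (hframe.mono (by omega)).trans hframe'⟩
    have hpotential : ((treeAt a τ).raise (τ.reg 7) (σ.reg 5)).potential N =
        (treeAt a τ).potential N := rfl
    simp
    omega

end Specifications

end RAM

/-! ## The program for relational event graphs -/

namespace RAM

open BottleneckTree

attribute [local simp] Expr.Fits Expr.val Expr.cost Cond.Fits Cond.Holds Cond.cost Memory.setReg
  Memory.setArr Function.update_apply

/-- Insert the edge whose endpoints and weight are the values of `u`, `v` and `c` into the tree at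
`a`, and append the weight of the superfluous edge to the array `y`. The recorded numbers are
greater by one, since data sets for dominance counting have positive coordinates. -/
def stepProgram (a y : ℕ) (u v c : Expr) : Program :=
  .seq (.assign 3 u) <| .seq (.assign 4 v) <| .seq (.assign 5 c) <|
  .seq (insertProgram a) (.store y (.reg 2) (.add (.reg 6) (.lit 1)))

/-- The first endpoint of the edge whose number is in register `2`. The vertex `x` of the graph is
encoded by `x + 1`, since `0` is the root of the trees. -/
def fstExpr : Expr := .add (.get 0 (.reg 2)) (.lit 1)

/-- The second endpoint, encoded as in `fstExpr`. -/
def sndExpr : Expr := .add (.get 1 (.reg 2)) (.lit 1)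

/-- One round for the edge whose number is in register `2`. The trees at `2`, `5` and `8` represent
`forestEdges`, `loopEdges` and `touchEdges`. -/
def roundProgram : Program :=
  .seq (stepProgram 2 12 fstExpr sndExpr (.add (.reg 2) (.lit 1))) <|
  .seq (stepProgram 5 13 fstExpr sndExpr (.add (.reg 2) (.lit 1))) <|
  .seq (stepProgram 5 14 fstExpr (.lit 0) (.sub (.get 12 (.reg 2)) (.lit 1))) <|
  .seq (stepProgram 8 15 fstExpr (.lit 0) (.add (.reg 2) (.lit 1))) <|
  .seq (stepProgram 8 16 sndExpr (.lit 0) (.add (.reg 2) (.lit 1))) <|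
  .seq (.store 11 (.reg 2) (.add (.reg 2) (.lit 2))) (.assign 2 (.add (.reg 2) (.lit 1)))

/-- Run `roundProgram` for all edges. Register `1` contains the number of edges. -/
def mainProgram : Program := .while (.lt (.reg 2) (.reg 1)) roundProgram

/-- The number by which the program refers to a vertex or to the root `none`. -/
def vertexCode {n : ℕ} (x : Option (Fin n)) : ℕ := x.elim 0 fun v => v + 1

/-- The edges that the program inserts. -/
def codedEdges (G : RelationalEventGraph) : RootedEdgeSequence ℕ := G.rootedEdges.map vertexCode

/-- The memory while the edge number `k` is processed, when the first `s` of its superfluous weights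
have been recorded and the tree at `a` represents `L a`. -/
structure RoundState (G : RelationalEventGraph) (k : ℕ) (L : ℕ → List (WeightedEdge ℕ)) (s : ℕ)
    (σ : Memory) : Prop where
  reg_one : σ.reg 1 = G.m
  reg_two : σ.reg 2 = k
  arr_zero : σ.arr 0 = (input G).arr 0
  arr_one : σ.arr 1 = (input G).arr 1
  represents : ∀ a ∈ ({2, 5, 8} : Finset ℕ), (treeAt a σ).Represents G.n G.m (L a)
  arr_x : ∀ i < k, σ.arr 11 i = i + 2
  arr_y : ∀ t < 5, ∀ i, i < k ∨ i = k ∧ t < s →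
    σ.arr (12 + t) i = (codedEdges G).recordedWeight i t + 1

/-- The sum of the potentials of the three trees. -/
def totalPotential (N : ℕ) (σ : Memory) : ℕ :=
  ∑ a ∈ {2, 5, 8}, (treeAt a σ).potential N

/-- The expression has the value `v` in all memories with the property `P`. -/
def Denotes (W S : ℕ) (P : Memory → Prop) (e : Expr) (v : ℕ) : Prop :=
  ∀ σ, P σ → e.Fits W S σ ∧ e.val σ = v

variable {W S : ℕ} {G : RelationalEventGraph} {k s : ℕ} {L : ℕ → List (WeightedEdge ℕ)}
  {σ τ : Memory}

theorem RoundState.setReg (h : RoundState G k L s σ) {x : ℕ} (hx : 3 ≤ x) (v : ℕ) :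
    RoundState G k L s (σ.setReg x v) where
  reg_one := by simp [show 1 ≠ x by omega, h.reg_one]
  reg_two := by simp [show 2 ≠ x by omega, h.reg_two]
  arr_zero := h.arr_zero
  arr_one := h.arr_one
  represents := h.represents
  arr_x := h.arr_x
  arr_y := h.arr_y

theorem treeAt_eq_of_frame {a b lo : ℕ} (ha : a ∈ ({2, 5, 8} : Finset ℕ))
    (hb : b ∈ ({2, 5, 8} : Finset ℕ)) (hab : b ≠ a) (h : Frame a lo σ τ) :
    treeAt b τ = treeAt b σ := by
  simp only [Finset.mem_insert, Finset.mem_singleton] at ha hb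
  simp only [treeAt]
  rw [h.arr_eq b (by omega), h.arr_eq (b + 1) (by omega), h.arr_eq (b + 2) (by omega)]

theorem totalPotential_add_of_frame {a N lo : ℕ} (ha : a ∈ ({2, 5, 8} : Finset ℕ))
    (h : Frame a lo σ τ) :
    totalPotential N τ + (treeAt a σ).potential N =
      totalPotential N σ + (treeAt a τ).potential N := by
  rw [totalPotential, totalPotential, ← Finset.add_sum_erase _ _ ha, ← Finset.add_sum_erase _ _ ha,
    Finset.sum_congr rfl fun b hb => by
      rw [treeAt_eq_of_frame ha (Finset.mem_of_mem_erase hb) (Finset.ne_of_mem_erase hb) h]]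
  omega

theorem treeAt_setArr {a y : ℕ} (ha : a ∈ ({2, 5, 8} : Finset ℕ)) (hy : 11 ≤ y) (σ : Memory)
    (i v : ℕ) : treeAt a (σ.setArr y i v) = treeAt a σ := by
  simp only [Finset.mem_insert, Finset.mem_singleton] at ha
  simp [treeAt, show a ≠ y by omega, show a + 1 ≠ y by omega, show a + 2 ≠ y by omega]

theorem totalPotential_setArr {y : ℕ} (hy : 11 ≤ y) (N : ℕ) (σ : Memory) (i v : ℕ) :
    totalPotential N (σ.setArr y i v) = totalPotential N σ :=
  Finset.sum_congr rfl fun _ hb => by rw [treeAt_setArr hb hy]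

theorem RoundState.record (h : RoundState G k L s σ) {a : ℕ} {e : WeightedEdge ℕ}
    (ha : a ∈ ({2, 5, 8} : Finset ℕ)) (hframe : Frame a 3 σ τ)
    (hτ : (treeAt a τ).Represents G.n G.m (e :: L a)) :
    RoundState G k (Function.update L a (e :: L a)) (s + 1)
      (τ.setArr (12 + s) k ((codedEdges G).recordedWeight k s + 1)) := by
  have ha' := ha
  simp only [Finset.mem_insert, Finset.mem_singleton] at ha'
  refine ⟨(hframe.reg_eq 1 (by omega)).trans h.reg_one,
    (hframe.reg_eq 2 (by omega)).trans h.reg_two, ?_, ?_, fun b hb => ?_, fun i hi => ?_,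
    fun t ht i hi => ?_⟩
  · simp [hframe.arr_eq 0 (by omega), show 0 ≠ 12 + s by omega, h.arr_zero]
  · simp [hframe.arr_eq 1 (by omega), show 1 ≠ 12 + s by omega, h.arr_one]
  · rw [treeAt_setArr hb (by omega)]
    rcases eq_or_ne b a with rfl | hba
    · simpa using hτ
    · rw [treeAt_eq_of_frame ha hb hba hframe, Function.update_of_ne hba]
      exact h.represents b hb
  · simpa [hframe.arr_eq 11 (by omega), show 11 ≠ 12 + s by omega] using h.arr_x i hi
  · have harr := hframe.arr_eq (12 + t) (by omega)
    by_cases hnew : t = s ∧ i = k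
    · simp [hnew.1, hnew.2]
    · have hold : (τ.setArr (12 + s) k ((codedEdges G).recordedWeight k s + 1)).arr (12 + t) i =
          σ.arr (12 + t) i := by
        rw [← harr]
        rcases eq_or_ne t s with rfl | hts
        · simp [show i ≠ k from fun hik => hnew ⟨rfl, hik⟩]
        · simp [hts]
      rw [hold]
      exact h.arr_y t ht i (by omega)

/-- The lists of edges that are represented by the trees at `2`, `5` and `8`. -/
noncomputable def maintainedEdges {α : Type*} (q : RootedEdgeSequence α) (k a : ℕ) :
    List (WeightedEdge α) :=
  if a = 2 then q.forestEdges k else if a = 5 then q.loopEdges k else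
  if a = 8 then q.touchEdges k else []

theorem maintainedEdges_succ {α : Type*} (q : RootedEdgeSequence α) (k : ℕ) :
    maintainedEdges q (k + 1) =
      Function.update (Function.update (Function.update (maintainedEdges q k)
        2 (q.edge k :: q.forestEdges k))
        5 (q.loopEdge k :: q.edge k :: q.loopEdges k))
        8 (q.sndTouchEdge k :: q.fstTouchEdge k :: q.touchEdges k) := by
  ext1 a
  simp only [maintainedEdges, Function.update_apply, RootedEdgeSequence.forestEdges,
    RootedEdgeSequence.loopEdges, RootedEdgeSequence.touchEdges]
  split_ifs <;> first | rfl | omega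

theorem vertexCode_injective {n : ℕ} : Function.Injective (vertexCode (n := n)) := by
  rintro (_ | x) (_ | y) h <;> simp_all [vertexCode, Fin.ext_iff]

theorem fst_codedEdges (hk : k < G.m) : (codedEdges G).fst k = (input G).arr 0 k + 1 := by
  simp [codedEdges, RootedEdgeSequence.map, RelationalEventGraph.rootedEdges, vertexCode, input, hk]

theorem snd_codedEdges (hk : k < G.m) : (codedEdges G).snd k = (input G).arr 1 k + 1 := by
  simp [codedEdges, RootedEdgeSequence.map, RelationalEventGraph.rootedEdges, vertexCode, input, hk]

theorem fst_codedEdges_mem_Icc (hk : k < G.m) : (codedEdges G).fst k ∈ Finset.Icc 1 G.n := by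
  simp [fst_codedEdges hk, input, hk]

theorem snd_codedEdges_mem_Icc (hk : k < G.m) : (codedEdges G).snd k ∈ Finset.Icc 1 G.n := by
  simp [snd_codedEdges hk, input, hk]

theorem RoundState.next (h : RoundState G k L 5 σ) :
    RoundState G (k + 1) L 0 ((σ.setArr 11 k (k + 2)).setReg 2 (k + 1)) where
  reg_one := h.reg_one
  reg_two := by simp
  arr_zero := h.arr_zero
  arr_one := h.arr_one
  represents a ha := by
    rw [treeAt_setReg, treeAt_setArr ha le_rfl]
    exact h.represents a ha
  arr_x i hi := by
    rcases eq_or_ne i k with rfl | hik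
    · simp
    · simpa [hik] using h.arr_x i (by omega)
  arr_y t ht i hi := by
    simpa [show 12 + t ≠ 11 by omega] using h.arr_y t ht i (by omega)

section Specifications

variable (hW : 4 * G.n + G.m + 10 < W)
include hW

theorem denotes_add_one (hk : k < G.m) :
    Denotes W S (RoundState G k L s) (.add (.reg 2) (.lit 1)) (k + 1) := fun σ hσ => by
  simp only [Expr.Fits, Expr.val, hσ.reg_two, and_true]
  omega

theorem denotes_zero : Denotes W S (RoundState G k L s) (.lit 0) (codedEdges G).root :=
  fun _ _ => ⟨show 0 < W by omega, rfl⟩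

variable (hS : G.n + G.m < S)
include hS

theorem denotes_fstExpr (hk : k < G.m) :
    Denotes W S (RoundState G k L s) fstExpr ((codedEdges G).fst k) := fun σ hσ => by
  have hfst := Finset.mem_Icc.1 (fst_codedEdges_mem_Icc hk)
  rw [fst_codedEdges hk] at hfst ⊢
  simp only [Expr.Fits, Expr.val, fstExpr, hσ.reg_two, hσ.arr_zero, and_true]
  omega

theorem denotes_sndExpr (hk : k < G.m) :
    Denotes W S (RoundState G k L s) sndExpr ((codedEdges G).snd k) := fun σ hσ => by
  have hsnd := Finset.mem_Icc.1 (snd_codedEdges_mem_Icc hk)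
  rw [snd_codedEdges hk] at hsnd ⊢
  simp only [Expr.Fits, Expr.val, sndExpr, hσ.reg_two, hσ.arr_one, and_true]
  omega

theorem denotes_cycleWeight (hk : k < G.m) (hs : 0 < s) :
    Denotes W S (RoundState G k L s) (.sub (.get 12 (.reg 2)) (.lit 1))
      ((codedEdges G).cycleWeight k) := fun σ hσ => by
  have hle := (codedEdges G).recordedWeight_le k 0
  have harr := hσ.arr_y 0 (by omega) k (.inr ⟨rfl, hs⟩)
  simp only [RootedEdgeSequence.recordedWeight] at hle harr
  simp only [Expr.Fits, Expr.val, hσ.reg_two, harr]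
  omega

theorem ensures_stepProgram {a : ℕ} {u v c : Expr} {e : WeightedEdge ℕ}
    (hσ : RoundState G k L s σ) (hk : k < G.m) (ha : a ∈ ({2, 5, 8} : Finset ℕ))
    (hu : Denotes W S (RoundState G k L s) u e.fst) (hv : Denotes W S (RoundState G k L s) v e.snd)
    (hc : Denotes W S (RoundState G k L s) c e.weight) (hfst : e.fst ∈ Finset.Icc 1 G.n)
    (hsnd : e.snd ≤ G.n) (hweight : e.weight ≤ G.m)
    (he : (codedEdges G).recordedWeight k s = WeightedEdge.superfluousWeight (L a) e) :
    Ensures W S (stepProgram a (12 + s) u v c) σ fun t τ =>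
      t + 200 * totalPotential G.n τ ≤ 200 * totalPotential G.n σ +
          2000 * (Nat.log 2 G.n + 1) + (u.cost + v.cost + c.cost + 8) ∧
        RoundState G k (Function.update L a (e :: L a)) (s + 1) τ := by
  obtain ⟨huF, huv⟩ := hu σ hσ
  refine ensures_seq (ensures_assign huF ?_)
  have hσ₁ := hσ.setReg le_rfl (u.val σ)
  obtain ⟨hvF, hvv⟩ := hv _ hσ₁
  refine ensures_seq (ensures_assign hvF ?_)
  have hσ₂ := hσ₁.setReg (x := 4) (by omega) (v.val (σ.setReg 3 (u.val σ)))
  obtain ⟨hcF, hcv⟩ := hc _ hσ₂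
  refine ensures_seq (ensures_assign hcF ?_)
  rw [hcv, hvv, huv]
  set υ := ((σ.setReg 3 e.fst).setReg 4 e.snd).setReg 5 e.weight with hυ
  have hframe : Frame a 3 σ υ :=
    ((Frame.setReg _ _ le_rfl).trans (Frame.setReg _ _ (by omega))).trans
      (Frame.setReg _ _ (by omega))
  refine ensures_seq ((ensures_insertProgram (σ := υ) hW (by omega) (hσ.represents a ha) hfst hsnd
    hweight).mono ?_)
  rintro t τ ⟨ht, hτ, hreg, hframe'⟩
  have hframe'' := hframe.trans (hframe'.mono (by omega))
  have hk' : τ.reg 2 = k := (hframe''.reg_eq 2 (by omega)).trans hσ.reg_two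
  replace hτ : (treeAt a τ).Represents G.n G.m (e :: L a) := hτ
  have hreg' : τ.reg 6 = (codedEdges G).recordedWeight k s := hreg.trans he.symm
  have hle : (codedEdges G).recordedWeight k s ≤ k + 1 := RootedEdgeSequence.recordedWeight_le _ _ _
  refine ensures_store (by simp; omega) (by simp; omega) (by simp; omega) ⟨?_, ?_⟩
  · have htotal := totalPotential_add_of_frame (N := G.n) ha hframe''
    rw [totalPotential_setArr (by omega)]
    simp only [hυ, treeAt_setReg, Expr.cost] at ht ⊢
    omega
  · simpa [hk', hreg'] using hσ.record ha hframe'' hτ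

theorem ensures_roundProgram (hσ : RoundState G k (maintainedEdges (codedEdges G) k) 0 σ)
    (hk : k < G.m) :
    Ensures W S roundProgram σ fun t τ =>
      t + 200 * totalPotential G.n τ ≤ 200 * totalPotential G.n σ +
          10100 * (Nat.log 2 G.n + 1) ∧
        RoundState G (k + 1) (maintainedEdges (codedEdges G) (k + 1)) 0 τ := by
  set q := codedEdges G
  have hfst := fst_codedEdges_mem_Icc hk
  have hsnd := snd_codedEdges_mem_Icc hk
  have hsnd' := (Finset.mem_Icc.1 hsnd).2
  have hcycle : q.cycleWeight k ≤ G.m := (q.recordedWeight_le k 0).trans hk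
  refine ensures_seq ((ensures_stepProgram hW hS (e := q.edge k) hσ hk (by decide)
    (denotes_fstExpr hW hS hk) (denotes_sndExpr hW hS hk) (denotes_add_one hW hk) hfst hsnd'
    hk rfl).mono ?_)
  rintro t₁ σ₁ ⟨ht₁, hσ₁⟩
  refine ensures_seq ((ensures_stepProgram hW hS (e := q.edge k) hσ₁ hk (by decide)
    (denotes_fstExpr hW hS hk) (denotes_sndExpr hW hS hk) (denotes_add_one hW hk) hfst hsnd'
    hk rfl).mono ?_)
  rintro t₂ σ₂ ⟨ht₂, hσ₂⟩
  refine ensures_seq ((ensures_stepProgram hW hS (e := q.loopEdge k) hσ₂ hk (by decide)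
    (denotes_fstExpr hW hS hk) (denotes_zero hW) (denotes_cycleWeight hW hS hk (by omega)) hfst
    (Nat.zero_le _) hcycle rfl).mono ?_)
  rintro t₃ σ₃ ⟨ht₃, hσ₃⟩
  refine ensures_seq ((ensures_stepProgram hW hS (e := q.fstTouchEdge k) hσ₃ hk (by decide)
    (denotes_fstExpr hW hS hk) (denotes_zero hW) (denotes_add_one hW hk) hfst
    (Nat.zero_le _) hk rfl).mono ?_)
  rintro t₄ σ₄ ⟨ht₄, hσ₄⟩
  refine ensures_seq ((ensures_stepProgram hW hS (e := q.sndTouchEdge k) hσ₄ hk (by decide)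
    (denotes_sndExpr hW hS hk) (denotes_zero hW) (denotes_add_one hW hk) hsnd
    (Nat.zero_le _) hk rfl).mono ?_)
  rintro t₅ σ₅ ⟨ht₅, hσ₅⟩
  have hreg := hσ₅.reg_two
  refine ensures_seq (ensures_store (by simp; omega) (by simp; omega) (by simp; omega)
    (ensures_assign (by simp; omega) ⟨?_, ?_⟩))
  · change _ + 200 * totalPotential G.n (σ₅.setArr 11 _ _) ≤ _
    rw [totalPotential_setArr le_rfl]
    simp only [fstExpr, sndExpr, Expr.cost] at *
    omega
  · have hlists : maintainedEdges q (k + 1) = _ := maintainedEdges_succ q k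
    rw [hlists]
    simpa [hreg, Function.update_idem, maintainedEdges] using hσ₅.next

theorem ensures_mainProgram (hσ : RoundState G 0 (maintainedEdges (codedEdges G) 0) 0 σ) :
    Ensures W S mainProgram σ fun t τ =>
      t ≤ 200 * totalPotential G.n σ + 10104 * (G.m * (Nat.log 2 G.n + 1)) + 4 ∧
        RoundState G G.m (maintainedEdges (codedEdges G) G.m) 0 τ := by
  refine (ensures_while
    (fun τ => τ.reg 2 ≤ G.m ∧ RoundState G (τ.reg 2) (maintainedEdges (codedEdges G) (τ.reg 2)) 0 τ)
    (fun τ => 200 * totalPotential G.n τ + 10104 * ((G.m - τ.reg 2) * (Nat.log 2 G.n + 1)))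
    ?_ ?_ (by simpa [hσ.reg_two] using hσ)).mono ?_
  · rintro τ ⟨hle, hτ⟩
    have := hτ.reg_one
    simp
    omega
  · rintro τ ⟨-, hτ⟩ hlt
    have hlt' : τ.reg 2 < G.m := by simpa [hτ.reg_one] using hlt
    refine (ensures_roundProgram hW hS hτ hlt').mono ?_
    rintro t υ ⟨ht, hυ⟩
    have hstep : (G.m - τ.reg 2) * (Nat.log 2 G.n + 1) =
        (G.m - υ.reg 2) * (Nat.log 2 G.n + 1) + (Nat.log 2 G.n + 1) := by
      rw [← Nat.succ_mul, hυ.reg_two]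
      congr 1
      omega
    refine ⟨⟨hυ.reg_two ▸ hlt', hυ.reg_two.symm ▸ hυ⟩, ?_⟩
    simp only [Cond.cost, Expr.cost]
    omega
  · rintro t τ ⟨⟨hle, hτ⟩, hnot, ht⟩
    have hm : τ.reg 2 = G.m := by
      simp only [Cond.Holds, Expr.val, hτ.reg_one] at hnot
      omega
    rw [hm] at hτ
    refine ⟨?_, hτ⟩
    simp only [Cond.cost, Expr.cost, hσ.reg_two, Nat.sub_zero] at ht
    omega

end Specifications

theorem roundState_input (G : RelationalEventGraph) :
    RoundState G 0 (maintainedEdges (codedEdges G) 0) 0 (input G) where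
  reg_one := rfl
  reg_two := rfl
  arr_zero := rfl
  arr_one := rfl
  represents a ha := by
    have hnil : maintainedEdges (codedEdges G) 0 a = [] := by
      simp only [maintainedEdges]
      split_ifs <;> rfl
    have hzero : ∀ b, 2 ≤ b → (input G).arr b = 0 := fun b hb => by
      ext k
      simp [input, show b ≠ 0 by omega, show b ≠ 1 by omega]
    have ha' : 2 ≤ a := by
      simp only [Finset.mem_insert, Finset.mem_singleton] at ha
      omega
    rw [hnil, treeAt, hzero a ha', hzero (a + 1) (by omega), hzero (a + 2) (by omega)]
    exact represents_zero _ _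
  arr_x i hi := absurd hi (Nat.not_lt_zero i)
  arr_y t ht i hi := by omega

theorem totalPotential_input (G : RelationalEventGraph) : totalPotential G.n (input G) = 0 := by
  simp [totalPotential, treeAt, potential, input]

theorem exists_run_mainProgram (G : RelationalEventGraph) :
    ∃ t τ, Run (12000 * (G.n + G.m + 1)) (12000 * (G.n + G.m + 1)) mainProgram (input G) t τ ∧
      t ≤ 12000 * (G.m * (Nat.log 2 G.n + 1) + 1) ∧ τ.reg 1 = G.m ∧
      (∀ k < G.m, τ.arr 11 k = k + 2) ∧
      ∀ s < 5, ∀ k < G.m, τ.arr (12 + s) k = G.rootedEdges.recordedWeight k s + 1 := by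
  obtain ⟨t, τ, hrun, ht, hτ⟩ := ensures_mainProgram (W := 12000 * (G.n + G.m + 1))
    (S := 12000 * (G.n + G.m + 1)) (by omega) (by omega) (roundState_input G)
  rw [totalPotential_input] at ht
  refine ⟨t, τ, hrun, by omega, hτ.reg_one, hτ.arr_x, fun s hs k hk => ?_⟩
  rw [hτ.arr_y s hs k (.inl hk), codedEdges,
    RootedEdgeSequence.recordedWeight_map vertexCode_injective]

end RAM

/-! ## Cycles and components of multigraphs -/

section Multigraph

variable {α β : Type*} {H : Graph α β} {F : Set β} {x y : H.vertexSet} {e : β}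

/-- The simple graph of the edges in `F`, without their loops and multiplicities. Its vertex type is
that of `H`, so that it can be compared with the components of `H`. -/
abbrev restrictToSimpleGraph (H : Graph α β) (F : Set β) : SimpleGraph H.vertexSet :=
  (H.restrict F).toSimpleGraph

theorem reachable_of_isLink (he : e ∈ F) (h : H.IsLink e x y) :
    (restrictToSimpleGraph H F).Reachable x y := by
  by_cases hxy : x = y
  · rw [hxy]
  · exact SimpleGraph.Adj.reachable ⟨hxy, e, he, h⟩

theorem restrictToSimpleGraph_le : restrictToSimpleGraph H F ≤ H.toSimpleGraph :=
  fun _ _ ⟨hne, e, _, hlink⟩ => ⟨hne, e, hlink⟩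

theorem restrictToSimpleGraph_eq (hF : H.edgeSet ⊆ F) :
    restrictToSimpleGraph H F = H.toSimpleGraph :=
  restrictToSimpleGraph_le.antisymm fun _ _ ⟨hne, e, hlink⟩ =>
    ⟨hne, e, hF hlink.edge_mem, hlink⟩

theorem reachable_of_isCycleOn {l : ℕ} {v : Fin (l + 1) → H.vertexSet} {e : Fin (l + 1) → β}
    (h : H.IsCycleOn (fun t => (v t : α)) e) (t : Fin (l + 1)) (hF : ∀ s ≠ t, e s ∈ F) :
    (restrictToSimpleGraph H F).Reachable (v (t + 1)) (v t) := by
  have harc : ∀ s, (restrictToSimpleGraph H F).Reachable (v (t + 1)) (v (t + 1 + s)) := by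
    intro s
    induction s using Fin.induction with
    | zero => rw [add_zero]
    | succ s ih =>
      have hne : t + 1 + s.castSucc ≠ t := by
        rw [add_assoc, add_comm 1, Fin.coeSucc_eq_succ]
        simp
      have hlink := h.isLink (t + 1 + s.castSucc)
      rw [add_assoc _ s.castSucc, Fin.coeSucc_eq_succ] at hlink
      exact ih.trans (reachable_of_isLink (hF _ hne) hlink)
  have hlast := harc (Fin.last l)
  rwa [add_assoc, add_comm 1, Fin.last_add_one, add_zero] at hlast

theorem exists_edge_injective_of_isPath {p : (restrictToSimpleGraph H F).Walk x y}
    (hp : p.IsPath) : ∃ f : Fin p.length → β, Function.Injective f ∧ (∀ t, f t ∈ F) ∧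
      ∀ t : Fin p.length, H.IsLink (f t) (p.getVert t) (p.getVert (t + 1)) := by
  have hadj : ∀ t : Fin p.length, ∃ f ∈ F, H.IsLink f (p.getVert t : α) (p.getVert (t + 1) : α) :=
    fun t => (p.adj_getVert_succ t.2).2
  choose f hF hf using hadj
  refine ⟨f, fun s t hst => ?_, hF, hf⟩
  have hs := hf s
  rw [hst] at hs
  rcases hs.eq_and_eq_or_eq_and_eq (hf t) with ⟨hfst, -⟩ | ⟨hfst, hsnd⟩
  · exact Fin.ext (hp.getVert_injOn s.2.le t.2.le (Subtype.ext hfst))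
  · have hst := hp.getVert_injOn s.2.le (Nat.succ_le_of_lt t.2) (Subtype.ext hfst)
    have hts := hp.getVert_injOn (Nat.succ_le_of_lt s.2) t.2.le (Subtype.ext hsnd)
    omega

theorem isLoopy_of_reachable (he : e ∉ F) (hlink : H.IsLink e x y)
    (h : (restrictToSimpleGraph H F).Reachable x y) :
    H.IsLoopy (H.toSimpleGraph.connectedComponentMk x) := by
  obtain ⟨p, hp⟩ := h.exists_isPath
  obtain ⟨f, hinj, hF, hf⟩ := exists_edge_injective_of_isPath hp
  refine ⟨p.length, fun t => p.getVert t, Fin.snoc f e, ⟨fun s t hst => ?_, ?_, fun t => ?_⟩,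
    fun t => ?_⟩
  · exact Fin.ext (hp.getVert_injOn (Nat.le_of_lt_succ s.2) (Nat.le_of_lt_succ t.2)
      (Subtype.ext hst))
  · exact Fin.snoc_injective_iff.2 ⟨hinj, fun ⟨t, ht⟩ => he (ht ▸ hF t)⟩
  · induction t using Fin.lastCases with
    | last => simpa [Fin.last_add_one] using hlink.symm
    | cast t => simpa [Fin.coeSucc_eq_succ] using hf t
  · exact SimpleGraph.ConnectedComponent.sound
      (SimpleGraph.Reachable.mono restrictToSimpleGraph_le ⟨p.take t⟩).symm

/-- A tree component with a single vertex, that is, an isolated vertex without loops. These are the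
tree components that are not nontrivial. -/
def IsTrivialTreeComponent (H : Graph α β) (c : H.Component) : Prop :=
  H.IsTreeComponent c ∧ ¬ c.supp.Nontrivial

theorem isTrivialTreeComponent_iff :
    IsTrivialTreeComponent H (H.toSimpleGraph.connectedComponentMk x) ↔
      ∀ e y, ¬ H.IsLink e x y := by
  constructor
  · rintro ⟨htree, htrivial⟩ e y hlink
    obtain ⟨y, rfl⟩ : ∃ y' : H.vertexSet, (y' : α) = y := ⟨⟨y, hlink.right_mem⟩, rfl⟩
    rcases eq_or_ne x y with rfl | hxy
    · exact htree (isLoopy_of_reachable (Set.notMem_empty e) hlink .rfl)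
    · have hadj : H.toSimpleGraph.Adj x y := ⟨hxy, e, hlink⟩
      exact htrivial ⟨x, rfl, y, SimpleGraph.ConnectedComponent.sound hadj.symm.reachable, hxy⟩
  · intro h
    have hsupp : ∀ y ∈ (H.toSimpleGraph.connectedComponentMk x).supp, y = x := by
      intro y hy
      obtain ⟨p⟩ := SimpleGraph.ConnectedComponent.exact hy.symm
      cases p with
      | nil => rfl
      | cons hadj p => exact absurd hadj.2.choose_spec (h _ _)
    refine ⟨fun ⟨l, v, e, hcycle, hv⟩ => ?_, fun ⟨y, hy, z, hz, hyz⟩ => ?_⟩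
    · exact h (e 0) (v (0 + 1)) (hsupp _ (hv 0) ▸ hcycle.isLink 0)
    · exact hyz ((hsupp y hy).trans (hsupp z hz).symm)

end Multigraph

/-! ## Components of slices as classes of connected vertices -/

namespace RelationalEventGraph

open WeightedEdge RootedEdgeSequence

variable {G : RelationalEventGraph} {i j k : ℕ} {x y : Fin G.n}

/-- The vertex `x` as a vertex of a slice. -/
abbrev sliceVertex (G : RelationalEventGraph) (i j : ℕ) (x : Fin G.n) : (G.slice i j).vertexSet :=
  ⟨x, Set.mem_univ x⟩

/-- The component of the vertex `x` in a slice. -/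
def component (G : RelationalEventGraph) (i j : ℕ) (x : Fin G.n) : (G.slice i j).Component :=
  (G.slice i j).toSimpleGraph.connectedComponentMk (G.sliceVertex i j x)

/-- The graph on the vertices of a slice that has those of its edges whose number is less than
`k`. -/
abbrev slicePrefix (G : RelationalEventGraph) (i j k : ℕ) : SimpleGraph (G.slice i j).vertexSet :=
  restrictToSimpleGraph (G.slice i j) {e | e < k}

theorem isLink_edge {e : Fin G.m} (hi : i ≤ e) (hj : e ≤ j) :
    (G.slice i j).IsLink e (G.edge e).1 (G.edge e).2 :=
  ⟨⟨hi, hj⟩, .inl rfl⟩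

theorem edge_mem_forestEdges {e : Fin G.m} (he : e < k) :
    G.rootedEdges.edge e ∈ G.rootedEdges.forestEdges k :=
  (mem_forestEdges _ _).2 ⟨e, he, rfl⟩

theorem reachable_of_connected_forestEdges (hkj : k ≤ j + 1) (hkm : k ≤ G.m)
    (h : connected (G.rootedEdges.forestEdges k) (i + 1) (some x) (some y)) :
    (G.slicePrefix i j k).Reachable (G.sliceVertex i j x) (G.sliceVertex i j y) := by
  let prefixComponent := fun v => (G.slicePrefix i j k).connectedComponentMk (G.sliceVertex i j v)
  have hle : connected (G.rootedEdges.forestEdges k) (i + 1) ≤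
      Setoid.ker (Option.map prefixComponent) := by
    refine connected_le_iff.2 fun e he hθ => ?_
    obtain ⟨l, hl, rfl⟩ := (mem_forestEdges _ _).1 he
    have hedge := rootedEdges_edge (G := G) ⟨l, hl.trans_le hkm⟩
    rw [hedge] at hθ ⊢
    exact congrArg some (SimpleGraph.ConnectedComponent.sound (reachable_of_isLink hl
      (isLink_edge (Nat.le_of_succ_le_succ hθ) (Nat.le_of_lt_succ (hl.trans_le hkj)))))
  exact SimpleGraph.ConnectedComponent.exact (Option.some_injective _ (hle h))

theorem connected_forestEdges_of_reachable {u v : (G.slice i j).vertexSet}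
    (h : (G.slicePrefix i j k).Reachable u v) :
    connected (G.rootedEdges.forestEdges k) (i + 1) (some u) (some v) := by
  obtain ⟨p⟩ := h
  induction p with
  | nil => exact Setoid.refl' _ _
  | @cons u v w hadj _ ih =>
    refine Setoid.trans' _ ?_ ih
    obtain ⟨-, e, he, ⟨hi, -⟩, huv⟩ := hadj
    have hconn := connected_of_mem (θ := i + 1) (edge_mem_forestEdges he) (Nat.succ_le_succ hi)
    rw [rootedEdges_edge] at hconn
    rcases huv with huv | huv <;> rw [huv] at hconn
    exacts [hconn, Setoid.symm' _ hconn]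

theorem connected_forestEdges_iff (hkj : k ≤ j + 1) (hkm : k ≤ G.m) :
    connected (G.rootedEdges.forestEdges k) (i + 1) (some x) (some y) ↔
      (G.slicePrefix i j k).Reachable (G.sliceVertex i j x) (G.sliceVertex i j y) :=
  ⟨reachable_of_connected_forestEdges hkj hkm, connected_forestEdges_of_reachable⟩

theorem slicePrefix_eq_toSimpleGraph : G.slicePrefix i j (j + 1) = (G.slice i j).toSimpleGraph := by
  refine restrictToSimpleGraph_eq fun e he => ?_
  obtain ⟨x, y, hlink⟩ := (G.slice i j).edge_mem_iff_exists_isLink e |>.1 he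
  exact Nat.lt_succ_of_le hlink.1.2

theorem component_eq_iff (hj : j < G.m) : G.component i j x = G.component i j y ↔
    connected (G.rootedEdges.forestEdges (j + 1)) (i + 1) (some x) (some y) := by
  rw [connected_forestEdges_iff le_rfl hj, slicePrefix_eq_toSimpleGraph]
  exact SimpleGraph.ConnectedComponent.eq

theorem le_cycleWeight_iff {e : Fin G.m} (hj : e ≤ j) :
    i + 1 ≤ G.rootedEdges.cycleWeight e ↔ i ≤ e ∧ (G.slicePrefix i j e).Reachable
      (G.sliceVertex i j (G.edge e).1) (G.sliceVertex i j (G.edge e).2) := by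
  rw [cycleWeight, le_superfluousWeight_iff (Nat.le_add_left 1 i), rootedEdges_edge,
    connected_forestEdges_iff (hj.trans (Nat.le_succ j)) e.2.le, Nat.succ_le_succ_iff]

theorem exists_component_eq (c : (G.slice i j).Component) : ∃ x, G.component i j x = c :=
  c.ind fun x => ⟨x, rfl⟩

theorem isLoopy_iff {c : (G.slice i j).Component} : (G.slice i j).IsLoopy c ↔
    ∃ e : Fin G.m, e ≤ j ∧ i + 1 ≤ G.rootedEdges.cycleWeight e ∧
      G.component i j (G.edge e).1 = c := by
  constructor
  · rintro ⟨l, v, e, hcycle, hv⟩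
    -- The latest edge of a cycle joins vertices that earlier edges connect.
    obtain ⟨t, ht⟩ := Finite.exists_max e
    have hreach : (G.slicePrefix i j (e t)).Reachable (v (t + 1)) (v t) :=
      reachable_of_isCycleOn hcycle t fun s hs =>
        (ht s).lt_of_ne (hcycle.edge_injective.ne hs)
    obtain ⟨⟨hi, hj⟩, hedge⟩ := hcycle.isLink t
    refine ⟨e t, hj, (le_cycleWeight_iff hj).2 ⟨hi, ?_⟩, ?_⟩
    · rcases hedge with hedge | hedge <;> rw [hedge]
      exacts [hreach.symm, hreach]
    · rcases hedge with hedge | hedge <;> rw [hedge]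
      exacts [hv t, hv (t + 1)]
  · rintro ⟨e, hj, he, rfl⟩
    obtain ⟨hi, hreach⟩ := (le_cycleWeight_iff hj).1 he
    exact isLoopy_of_reachable (lt_irrefl (e : ℕ)) (isLink_edge hi hj) hreach

open Classical in
/-- The component of a vertex if it satisfies `P`. The root and the other vertices form one more
class. -/
noncomputable def componentClass (P : (G.slice i j).Component → Prop) (x : Option (Fin G.n)) :
    Option {c // P c} :=
  x.bind fun v => if hv : P (G.component i j v) then some ⟨G.component i j v, hv⟩ else none

section ComponentClass

variable {P : (G.slice i j).Component → Prop}

theorem componentClass_of_pos (hx : P (G.component i j x)) :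
    componentClass P (some x) = some ⟨G.component i j x, hx⟩ :=
  dif_pos hx

theorem componentClass_of_neg (hx : ¬ P (G.component i j x)) : componentClass P (some x) = none :=
  dif_neg hx

theorem componentClass_congr (hxy : G.component i j x = G.component i j y) :
    componentClass P (some x) = componentClass P (some y) := by
  by_cases hx : P (G.component i j x)
  · rw [componentClass_of_pos hx, componentClass_of_pos (hxy ▸ hx)]
    exact congrArg some (Subtype.ext hxy)
  · rw [componentClass_of_neg hx, componentClass_of_neg (hxy ▸ hx)]

theorem componentClass_edge (hj : j < G.m) (hik : i ≤ k) (hkj : k ≤ j) :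
    componentClass P (G.rootedEdges.edge k).fst = componentClass P (G.rootedEdges.edge k).snd := by
  have hkm := hkj.trans_lt hj
  rw [rootedEdges_edge ⟨k, hkm⟩]
  refine componentClass_congr ((component_eq_iff hj).2 ?_)
  have hconn := connected_of_mem (edge_mem_forestEdges (e := ⟨k, hkm⟩) (Nat.lt_succ_of_le hkj))
    (Nat.succ_le_succ hik)
  rwa [rootedEdges_edge ⟨k, hkm⟩] at hconn

theorem card_quotient_ker_componentClass :
    Nat.card (Quotient (Setoid.ker (componentClass P))) = Nat.card {c // P c} + 1 := by
  have hsurj : Function.Surjective (componentClass P) := by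
    rintro (_ | ⟨c, hc⟩)
    · exact ⟨none, rfl⟩
    · obtain ⟨x, rfl⟩ := exists_component_eq c
      exact ⟨some x, componentClass_of_pos hc⟩
  rw [Nat.card_congr (Setoid.quotientKerEquivOfSurjective _ hsurj), Finite.card_option]

theorem ker_componentClass_le {s : Setoid (Option (Fin G.n))}
    (hcomponent : ∀ x y, G.component i j x = G.component i j y → P (G.component i j x) →
      s (some x) (some y))
    (hroot : ∀ x, ¬ P (G.component i j x) → s (some x) none) :
    Setoid.ker (componentClass P) ≤ s := by
  have hnone : ∀ a, componentClass P a = none → s a none := by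
    rintro (_ | x) hx
    · exact s.refl' none
    · exact hroot x fun h => by simp [componentClass_of_pos h] at hx
  intro a b hab
  rcases hb : componentClass P b with _ | c
  · exact s.trans' (hnone a (hab.trans hb)) (s.symm' (hnone b hb))
  · obtain _ | x := a
    · exact absurd (hab.trans hb) (by simp [componentClass])
    obtain _ | y := b
    · exact absurd hb (by simp [componentClass])
    by_cases hx : P (G.component i j x)
    · by_cases hy : P (G.component i j y)
      · rw [Setoid.ker_def, componentClass_of_pos hx, componentClass_of_pos hy] at hab
        exact hcomponent x y (congrArg Subtype.val (Option.some_injective _ hab)) hx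
      · rw [componentClass_of_neg hy] at hb
        cases hb
    · rw [Setoid.ker_def, componentClass_of_neg hx, hb] at hab
      cases hab

theorem connected_forestEdges_eq (hj : j < G.m) :
    connected (G.rootedEdges.forestEdges (j + 1)) (i + 1) =
      Setoid.ker (componentClass fun _ : (G.slice i j).Component => True) := by
  refine le_antisymm (connected_le_iff.2 fun e he hθ => ?_) (ker_componentClass_le ?_ ?_)
  · obtain ⟨k, hk, rfl⟩ := (mem_forestEdges _ _).1 he
    exact componentClass_edge hj (Nat.le_of_succ_le_succ hθ) (Nat.le_of_lt_succ hk)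
  · exact fun x y hxy _ => (component_eq_iff hj).1 hxy
  · exact fun x hx => absurd trivial hx

theorem connected_loopEdges_of_component_eq (hj : j < G.m)
    (hxy : G.component i j x = G.component i j y) :
    connected (G.rootedEdges.loopEdges (j + 1)) (i + 1) (some x) (some y) := by
  have hforest : connected (G.rootedEdges.forestEdges (j + 1)) (i + 1) ≤
      connected (G.rootedEdges.loopEdges (j + 1)) (i + 1) := by
    refine connected_le_iff.2 fun e he hθ => connected_of_mem ?_ hθ
    obtain ⟨k, hk, rfl⟩ := (mem_forestEdges _ _).1 he
    exact (mem_loopEdges _ _).2 ⟨k, hk, .inr rfl⟩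
  exact hforest ((component_eq_iff hj).1 hxy)

theorem connected_loopEdges_of_isLoopy (hj : j < G.m)
    (hx : (G.slice i j).IsLoopy (G.component i j x)) :
    connected (G.rootedEdges.loopEdges (j + 1)) (i + 1) (some x) none := by
  obtain ⟨e, hej, he, hex⟩ := isLoopy_iff.1 hx
  have hloop := connected_of_mem
    ((mem_loopEdges G.rootedEdges (j + 1)).2 ⟨e, Nat.lt_succ_of_le hej, .inl rfl⟩) he
  rw [loopEdge, rootedEdges_fst] at hloop
  exact Setoid.trans' _ (connected_loopEdges_of_component_eq hj hex.symm) hloop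

theorem connected_loopEdges_eq (hj : j < G.m) :
    connected (G.rootedEdges.loopEdges (j + 1)) (i + 1) =
      Setoid.ker (componentClass (G.slice i j).IsTreeComponent) := by
  refine le_antisymm (connected_le_iff.2 fun e he hθ => ?_) (ker_componentClass_le ?_ ?_)
  · obtain ⟨k, hk, rfl | rfl⟩ := (mem_loopEdges _ _).1 he
    · lift k to Fin G.m using by omega
      rw [loopEdge, rootedEdges_fst]
      exact componentClass_of_neg (not_not.2 (isLoopy_iff.2 ⟨k, Nat.le_of_lt_succ hk, hθ, rfl⟩))
    · exact componentClass_edge hj (Nat.le_of_succ_le_succ hθ) (Nat.le_of_lt_succ hk)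
  · exact fun x y hxy _ => connected_loopEdges_of_component_eq hj hxy
  · exact fun x hx => connected_loopEdges_of_isLoopy hj (not_not.1 hx)

theorem connected_touchEdges_of_isLink {e : Fin G.m} (h : (G.slice i j).IsLink e x y) :
    connected (G.rootedEdges.touchEdges (j + 1)) (i + 1) (some x) none := by
  obtain ⟨⟨hi, hj⟩, hedge⟩ := h
  have hfst := connected_of_mem (θ := i + 1)
    ((mem_touchEdges G.rootedEdges (j + 1)).2 ⟨e, Nat.lt_succ_of_le hj, .inr rfl⟩)
    (Nat.succ_le_succ hi)
  have hsnd := connected_of_mem (θ := i + 1)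
    ((mem_touchEdges G.rootedEdges (j + 1)).2 ⟨e, Nat.lt_succ_of_le hj, .inl rfl⟩)
    (Nat.succ_le_succ hi)
  rw [fstTouchEdge, rootedEdges_fst] at hfst
  rw [sndTouchEdge, rootedEdges_snd] at hsnd
  rcases hedge with hedge | hedge <;> rw [hedge] at hfst hsnd
  exacts [hfst, hsnd]

theorem connected_touchEdges_eq (hj : j < G.m) :
    connected (G.rootedEdges.touchEdges (j + 1)) (i + 1) =
      Setoid.ker (componentClass (IsTrivialTreeComponent (G.slice i j))) := by
  have hneg : ∀ {e : Fin G.m} {x y}, (G.slice i j).IsLink e x y →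
      componentClass (IsTrivialTreeComponent (G.slice i j)) (some x) = none := fun hlink =>
    componentClass_of_neg fun htrivial => isTrivialTreeComponent_iff.1 htrivial _ _ hlink
  refine le_antisymm (connected_le_iff.2 fun e he hθ => ?_) (ker_componentClass_le ?_ ?_)
  · obtain ⟨k, hk, he⟩ := (mem_touchEdges _ _).1 he
    lift k to Fin G.m using by omega
    have hi : i ≤ k := by rcases he with rfl | rfl <;> exact Nat.le_of_succ_le_succ hθ
    have hlink := isLink_edge hi (Nat.le_of_lt_succ hk)
    rcases he with rfl | rfl
    · rw [sndTouchEdge, rootedEdges_snd]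
      exact hneg hlink.symm
    · rw [fstTouchEdge, rootedEdges_fst]
      exact hneg hlink
  · intro x y hxy hx
    have heq : G.sliceVertex i j x = G.sliceVertex i j y :=
      Set.not_nontrivial_iff.1 hx.2 rfl hxy.symm
    rw [Subtype.mk.inj heq]
  · intro x hx
    obtain ⟨e, y, hlink⟩ : ∃ e y, (G.slice i j).IsLink e x y := by
      simpa only [not_forall, not_not] using mt isTrivialTreeComponent_iff.2 hx
    exact connected_touchEdges_of_isLink hlink

end ComponentClass

/-- The number of the edges `e_0, …, e_j` with recorded weight of kind `t` at least `i + 1`. -/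
noncomputable def heavyCount (G : RelationalEventGraph) (i j t : ℕ) : ℕ :=
  Nat.count (fun k => i + 1 ≤ G.rootedEdges.recordedWeight k t) (j + 1)

theorem card_component_add (hj : j < G.m) :
    Nat.card (G.slice i j).Component + (j + 1 - i) = G.n + G.heavyCount i j 0 := by
  have hcard := card_quotient_forestEdges G.rootedEdges i (j + 1)
  rw [connected_forestEdges_eq hj, card_quotient_ker_componentClass,
    Nat.card_congr (Equiv.subtypeUnivEquiv fun _ => trivial), Finite.card_option,
    Nat.card_fin] at hcard
  rw [heavyCount]
  omega

theorem treeComponentCount_add (hj : j < G.m) :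
    (G.slice i j).treeComponentCount + ((j + 1 - i) + G.heavyCount i j 0) =
      G.n + (G.heavyCount i j 1 + G.heavyCount i j 2) := by
  have hcard := card_quotient_loopEdges G.rootedEdges i (j + 1)
  rw [connected_loopEdges_eq hj, card_quotient_ker_componentClass, Finite.card_option,
    Nat.card_fin] at hcard
  simp only [heavyCount, Graph.treeComponentCount]
  omega

theorem card_isTrivialTreeComponent_add (hj : j < G.m) :
    Nat.card {c // IsTrivialTreeComponent (G.slice i j) c} + 2 * (j + 1 - i) =
      G.n + (G.heavyCount i j 3 + G.heavyCount i j 4) := by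
  have hcard := card_quotient_touchEdges G.rootedEdges i (j + 1)
  rw [connected_touchEdges_eq hj, card_quotient_ker_componentClass, Finite.card_option,
    Nat.card_fin] at hcard
  simp only [heavyCount]
  omega

end RelationalEventGraph

/-! ## The reduction -/

theorem card_subtype_and_add_card_subtype_and_not {α : Type*} [Finite α] (p q : α → Prop) :
    Nat.card {a // p a ∧ q a} + Nat.card {a // p a ∧ ¬ q a} = Nat.card {a // p a} := by
  classical
  rw [← Nat.card_congr (Equiv.subtypeSubtypeEquivSubtypeInter p q),
    ← Nat.card_congr (Equiv.subtypeSubtypeEquivSubtypeInter p (¬ q ·)), ← Nat.card_sum]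
  exact Nat.card_congr (Equiv.sumCompl fun a : {a // p a} => q a)

namespace RelationalEventGraph

variable {G : RelationalEventGraph} {i j : ℕ}

theorem loopyComponentCount_eq (hj : j < G.m) :
    ((G.slice i j).loopyComponentCount : ℤ) =
      2 * G.heavyCount i j 0 - G.heavyCount i j 1 - G.heavyCount i j 2 := by
  have hsplit : (G.slice i j).loopyComponentCount + (G.slice i j).treeComponentCount =
      Nat.card (G.slice i j).Component := by
    classical
    rw [Graph.loopyComponentCount, Graph.treeComponentCount, ← Nat.card_sum]
    exact Nat.card_congr (Equiv.sumCompl _)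
  have hcomponent := card_component_add (i := i) hj
  have htree := treeComponentCount_add (i := i) hj
  omega

theorem treeComponentCount_eq (hij : i ≤ j) (hj : j < G.m) :
    ((G.slice i j).treeComponentCount : ℤ) = G.n + i - j - 1 -
      G.heavyCount i j 0 + G.heavyCount i j 1 + G.heavyCount i j 2 := by
  have htree := treeComponentCount_add (i := i) hj
  omega

theorem nontrivialTreeComponentCount_eq (hij : i ≤ j) (hj : j < G.m) :
    ((G.slice i j).nontrivialTreeComponentCount : ℤ) = j - i + 1 - G.heavyCount i j 0 +
      G.heavyCount i j 1 + G.heavyCount i j 2 - G.heavyCount i j 3 - G.heavyCount i j 4 := by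
  have hsplit : (G.slice i j).nontrivialTreeComponentCount +
      Nat.card {c // IsTrivialTreeComponent (G.slice i j) c} = (G.slice i j).treeComponentCount :=
    card_subtype_and_add_card_subtype_and_not _ _
  have htree := treeComponentCount_add (i := i) hj
  have htrivial := card_isTrivialTreeComponent_add (i := i) hj
  omega

end RelationalEventGraph

/-- The points of the superfluous weights of kind `t`, with coordinates that satisfy
`1 ≤ y ≤ x`. -/
noncomputable def recordedPoints (G : RelationalEventGraph) (t : ℕ) : List (ℕ × ℕ) :=
  (List.range G.m).map fun k => (k + 2, G.rootedEdges.recordedWeight k t + 1)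

/-- The place where the main program leaves `recordedPoints`. -/
def recordedLocation (t : ℕ) : PointSetLocation := ⟨1, 11, 12 + t⟩

section RecordedPoints

variable {G : RelationalEventGraph} {t : ℕ}

theorem points_recordedLocation {σ : RAM.Memory} (hreg : σ.reg 1 = G.m)
    (hx : ∀ k < G.m, σ.arr 11 k = k + 2)
    (hy : ∀ k < G.m, σ.arr (12 + t) k = G.rootedEdges.recordedWeight k t + 1) :
    (recordedLocation t).points σ = recordedPoints G t := by
  rw [PointSetLocation.points, recordedLocation, hreg]
  refine List.map_congr_left fun k hk => ?_
  rw [hx k (List.mem_range.1 hk), hy k (List.mem_range.1 hk)]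

theorem isDominanceData_recordedPoints : IsDominanceData (2 * G.m) (recordedPoints G t) where
  nodup := List.nodup_range.map fun k l hkl => by simpa using congrArg Prod.fst hkl
  length_le := by
    rw [recordedPoints, List.length_map, List.length_range]
    omega
  mem_grid p hp := by
    obtain ⟨k, hk, rfl⟩ := List.mem_map.1 hp
    have hle := G.rootedEdges.recordedWeight_le k t
    have hkm := List.mem_range.1 hk
    dsimp only
    omega

theorem dominanceCount_recordedPoints {i j : ℕ} (hj : j < G.m) :
    dominanceCount (recordedPoints G t) ⟨true, false⟩ (j + 2) (i + 2) = G.heavyCount i j t :=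
  calc
    _ = Nat.count (fun k => k < j + 1 ∧ i + 1 ≤ G.rootedEdges.recordedWeight k t) G.m := by
      rw [dominanceCount, recordedPoints, List.countP_map, Nat.count]
      refine List.countP_congr fun k _ => ?_
      simp only [Function.comp_apply, if_true, Bool.false_eq_true, if_false, Bool.and_eq_true,
        decide_eq_true_eq]
      omega
    _ = G.heavyCount i j t := by
      rw [RelationalEventGraph.heavyCount, Nat.count_eq_card_filter_range,
        Nat.count_eq_card_filter_range]
      congr 1
      ext k
      simp only [Finset.mem_filter, Finset.mem_range]
      omega

end RecordedPoints

/-- The query that counts `heavyCount` with the given coefficient. -/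
def heavyCountQuery (coeff : ℤ) (t : ℕ) : DominanceQuery :=
  ⟨coeff, recordedLocation t, ⟨true, false⟩, ⟨0, 0, 0, 1, 2⟩, ⟨0, 0, 1, 0, 2⟩⟩

theorem reducesToDominanceCounting_of_heavyCount {f : ∀ {n m : ℕ}, Graph (Fin n) (Fin m) → ℕ}
    (base : AffineForm) (c : Fin 5 → ℤ)
    (hf : ∀ (G : RelationalEventGraph) (i j : ℕ), i ≤ j → j < G.m →
      (f (G.slice i j) : ℤ) = base.eval G.n G.m i j + ∑ t, c t * G.heavyCount i j t) :
    ReducesToDominanceCounting f (fun n m => m * (Nat.log 2 n + 1) + 1)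
      (fun n m => n + m + 1) := by
  refine ⟨RAM.mainProgram, ⟨base, List.ofFn fun t : Fin 5 => heavyCountQuery (c t) t⟩, 12000,
    fun G => ?_⟩
  obtain ⟨t, σ, hrun, ht, hreg, hx, hy⟩ := RAM.exists_run_mainProgram G
  have hpoints : ∀ s : Fin 5, (recordedLocation s).points σ = recordedPoints G s :=
    fun s => points_recordedLocation hreg hx (hy s s.2)
  refine ⟨t, σ, hrun, ht, fun d hd => ?_, fun i j hij hj => ?_⟩
  · obtain ⟨s, rfl⟩ := List.mem_ofFn.1 hd
    refine ⟨2 * G.m, by omega, ?_⟩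
    rw [heavyCountQuery, hpoints]
    exact isDominanceData_recordedPoints
  · rw [hf G i j hij hj, QueryScheme.answer, List.map_ofFn, List.sum_ofFn]
    congr 1
    refine Finset.sum_congr rfl fun s _ => ?_
    simp only [Function.comp_apply, heavyCountQuery, hpoints, AffineForm.eval]
    rw [← dominanceCount_recordedPoints hj]
    congr 3 <;> ring

theorem mainTheorem3 :
    ReducesToDominanceCounting (fun H => H.loopyComponentCount)
        (fun n m => m * (Nat.log 2 n + 1) + 1) (fun n m => n + m + 1) ∧
      ReducesToDominanceCounting (fun H => H.treeComponentCount)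
        (fun n m => m * (Nat.log 2 n + 1) + 1) (fun n m => n + m + 1) ∧
      ReducesToDominanceCounting (fun H => H.nontrivialTreeComponentCount)
        (fun n m => m * (Nat.log 2 n + 1) + 1) (fun n m => n + m + 1) := by
  refine ⟨reducesToDominanceCounting_of_heavyCount ⟨0, 0, 0, 0, 0⟩ ![2, -1, -1, 0, 0]
      fun G i j _ hj => ?_,
    reducesToDominanceCounting_of_heavyCount ⟨1, 0, 1, -1, -1⟩ ![-1, 1, 1, 0, 0]
      fun G i j hij hj => ?_,
    reducesToDominanceCounting_of_heavyCount ⟨0, 0, -1, 1, 1⟩ ![-1, 1, 1, -1, -1]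
      fun G i j hij hj => ?_⟩
  on_goal 1 => rw [RelationalEventGraph.loopyComponentCount_eq hj]
  on_goal 2 => rw [RelationalEventGraph.treeComponentCount_eq hij hj]
  on_goal 3 => rw [RelationalEventGraph.nontrivialTreeComponentCount_eq hij hj]
  all_goals
    simp only [AffineForm.eval, Fin.sum_univ_five, Matrix.cons_val, Fin.coe_ofNat_eq_mod,
      Nat.reduceMod, Nat.zero_mod, Nat.one_mod, Fin.isValue]
    ring
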